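/- Let $n$ be an integer. Consider finite sets $R$ of pairs $(i,k)$ of integers with $i,k\le n$. Draw $R$ as a table with rows $n,n-1,n-2,\dots$ from top to bottom and columns $n,n-1,n-2,\dots$ from left to right, $(i,k)$ being the place in column $i$ and row $k$. For every integer $a\le n$ the *strand* $a$ starts at the left end of row $a$ and travels right and up: at a place of $R$ the two strands passing through it cross, each going straight on; at any other place they do not intersect, the one coming from the left (the *top* strand) turning up and the one coming from below (the *bottom* strand) turning right. $R$ is an *rc-graph* if no two strands intersect twice. A place $(i,k)\notin R$ is an *open space* of $R$ if its top strand has a positive label and its bottom strand a nonpositive one. For $1\le k\le n$, the *insertion* $R\leftarrow k$ is the result of the following algorithm. Put $k_1=k$, let $i_1$ be the smallest integer such that $(i_1,k_1)$ is an open space of $R$, and add $(i_1,k_1)$ to $R$. Whenever, after a place $(i_j,k_j)$ has been added, the current set is an rc-graph, stop. Otherwise the two strands intersecting at $(i_j,k_j)$ also intersect at another place $(\ell_{j+1},k_{j+1})$ with $k_{j+1}>k_j$; remove it, let $i_{j+1}$ be the smallest integer $>\ell_{j+1}$ such that $(i_{j+1},k_{j+1})$ is an open space of the set so obtained, add $(i_{j+1},k_{j+1})$,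 and repeat. For a word $v=v_1v_2\cdots v_m$ in $1,\dots,n$, let $R\leftarrow v$ be the result of inserting $v_1$, then $v_2$, and so on up to $v_m$. **Lemma.** Let $R$ be an rc-graph in which no two strands with nonpositive labels intersect. Then, for integers $x,y,z$, $$R\leftarrow yxz=R\leftarrow yzx\quad\text{if } 0<x<y\le z\le n,$$ $$R\leftarrow xzy=R\leftarrow zxy\quad\text{if } 0<x\le y<z\le n,$$ where in each case both sides are well defined. -/

import Mathlib

/-!
RC-graphs, their strands, and the insertion algorithm.

A place is a pair `(i, k)` of integers `≤ n`, where `i` is the column and `k` the row.  The table is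
drawn with the rows `n, n - 1, n - 2, …` from top to bottom and the columns `n, n - 1, n - 2, …` from
left to right, so a step to the right lowers the column by one and a step up raises the row by one.
-/

namespace RCGraph

/-- The two sides through which a strand can enter a place: strands travel to the right and up. -/
inductive Side
  | left
  | bottom

/-- `Enters n R a s (i, k)`: in the table of `R` the strand labelled `a` (the one that starts at the
left end of row `a`) enters the place `(i, k)` through its side `s`.  At a place of `R` the two strands
cross, each going straight on.  At any other place they do not: the strand entering from the left
turns up, and the strand entering from the bottom turns right. -/
inductive Enters (n : ℤ) (R : Finset (ℤ × ℤ)) (a : ℤ) : Side → ℤ × ℤ → Prop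
  | start : a ≤ n → Enters n R a .left (n, a)
  | cross_right {i k : ℤ} :
      Enters n R a .left (i, k) → (i, k) ∈ R → Enters n R a .left (i - 1, k)
  | cross_up {i k : ℤ} :
      Enters n R a .bottom (i, k) → (i, k) ∈ R → k < n → Enters n R a .bottom (i, k + 1)
  | turn_up {i k : ℤ} :
      Enters n R a .left (i, k) → (i, k) ∉ R → k < n → Enters n R a .bottom (i, k + 1)
  | turn_right {i k : ℤ} :
      Enters n R a .bottom (i, k) → (i, k) ∉ R → Enters n R a .left (i - 1, k)

/-- The strands labelled `a` and `b` intersect at the place `p`. -/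
def IntersectAt (n : ℤ) (R : Finset (ℤ × ℤ)) (a b : ℤ) (p : ℤ × ℤ) : Prop :=
  p ∈ R ∧ ((Enters n R a .left p ∧ Enters n R b .bottom p) ∨
    (Enters n R b .left p ∧ Enters n R a .bottom p))

/-- A finite set of places is an rc-graph if no two strands intersect twice. -/
def IsRCGraph (n : ℤ) (R : Finset (ℤ × ℤ)) : Prop :=
  (∀ p ∈ R, p.1 ≤ n ∧ p.2 ≤ n) ∧
    ∀ a b p q, IntersectAt n R a b p → IntersectAt n R a b q → p = q

/-- No two strands with nonpositive labels intersect. -/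
def NoNonposIntersect (n : ℤ) (R : Finset (ℤ × ℤ)) : Prop :=
  ∀ a b p, IntersectAt n R a b p → 0 < a ∨ 0 < b

/-- `p` is an open space: the strands at `p` do not intersect, the top strand (which joins the left
side of `p` to its top side) has a positive label, and the bottom strand (which joins the bottom side
of `p` to its right side) has a nonpositive label. -/
def IsOpenSpace (n : ℤ) (R : Finset (ℤ × ℤ)) (p : ℤ × ℤ) : Prop :=
  p.1 ≤ n ∧ p.2 ≤ n ∧ p ∉ R ∧
    ∃ a b, b ≤ 0 ∧ 0 < a ∧ Enters n R a .left p ∧ Enters n R b .bottom p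

/-- `Run n S p U`: the insertion algorithm, when it is about to insert the place `p` into `S`, stops
with the result `U`.  After inserting `p` it stops if the outcome is an rc-graph.  Otherwise it removes
another place `(l, k)`, in a higher row, where the two strands that intersect at `p` intersect too, and
continues with the open space `(i, k)` of the new table for which `i > l` is smallest. -/
inductive Run (n : ℤ) : Finset (ℤ × ℤ) → ℤ × ℤ → Finset (ℤ × ℤ) → Prop
  | halt {S : Finset (ℤ × ℤ)} {p : ℤ × ℤ} :
      IsRCGraph n (insert p S) → Run n S p (insert p S)
  | bump {S U : Finset (ℤ × ℤ)} {p : ℤ × ℤ} {a b l k i : ℤ} :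
      ¬ IsRCGraph n (insert p S) →
      IntersectAt n (insert p S) a b p →
      IntersectAt n (insert p S) a b (l, k) →
      p.2 < k →
      IsLeast {j | l < j ∧ IsOpenSpace n ((insert p S).erase (l, k)) (j, k)} i →
      Run n ((insert p S).erase (l, k)) (i, k) U →
      Run n S p U

/-- `Inserts n R k U`: the algorithm inserting the number `k` into `R` stops with the result `U`, that
is, `R ← k` is defined and equal to `U`.  It starts with the open space `(i, k)` for which `i` is
smallest. -/
def Inserts (n : ℤ) (R : Finset (ℤ × ℤ)) (k : ℤ) (U : Finset (ℤ × ℤ)) : Prop :=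
  ∃ i, IsLeast {j | IsOpenSpace n R (j, k)} i ∧ Run n R (i, k) U

/-- `InsertsWord n R v U`: inserting the letters of the word `v` into `R` one by one, from the first
to the last, gives the result `U`. -/
def InsertsWord (n : ℤ) : Finset (ℤ × ℤ) → List ℤ → Finset (ℤ × ℤ) → Prop
  | R, [], U => U = R
  | R, k :: v, U => ∃ R', Inserts n R k R' ∧ InsertsWord n R' v U

/-- `R ← v = R ← v'`, both sides being defined: the insertions of the two words into `R` stop with one
and the same result `U`, and with no other result. -/
def SameInsertion (n : ℤ) (R : Finset (ℤ × ℤ)) (v v' : List ℤ) : Prop :=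
  ∃ U, (∀ V, InsertsWord n R v V ↔ V = U) ∧ (∀ V, InsertsWord n R v' V ↔ V = U)

end RCGraph

/-! ### Words, hops and crossings: a hop passing one crossing -/

namespace RCGraph

/-! Give the place (i, k) the coordinate q = n - i - k and read the table row by row, upwards. The
strands form a word: it starts as q ↦ -q, and a crossing at q exchanges the entries at q and q + 1.
In an rc-graph as in the lemma every crossing moves a positive entry past a smaller one
(`exists_rows`), and conversely rows of such crossings form an rc-graph (`Rows.isRCGraph`).

Inserting x adds a crossing at the end of row x, at the last positive entry. From there on the new
word differs from the old one by a single transposition, a hop: a positive entry is exchanged with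
the first nonpositive entry to its right, all entries in between being larger than the positive one.
Each crossing above either carries the hop along, or exchanges the very two strands of the hop. In
the second case they meet twice, the crossing is moved left to the last positive entry, and the hop
is replaced by a new one there. This is the removal and reinsertion of the algorithm (`Pass`,
`Mid.step_bump`, `inserts_iff`).

Each side of the lemma is thus a triple of hops rising through the rows of R. `Exch` lists three
configurations in which two triples have the same effect: two hops commute after the first one
(`right`) or before the third one (`left`), or they satisfy a `braid` identity. The core is
`Exch.pass`: a crossing passed by both triples ends at the same place, and the triples stay related,
possibly in another configuration. Hence triples related after row z give equal rows above z
(`InsRows.rows_eq_of_exch`).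

Below z the insertion of z has no effect. In row z itself the first relation is of type `right`, the
hop of y separating those of x and z. For the second one, the crossing added by z is treated as if
bumped from a place far to the right (`Exch.of_last`). -/

/-- The word `v` with its entries at `s` and `t` exchanged. -/
def swp (s t : ℤ) (v : ℤ → ℤ) : ℤ → ℤ :=
  fun i => if i = s then v t else if i = t then v s else v i

/-- The place to which `i` moves when the entries at `r` and `r + 1` are exchanged. -/
def sw (r i : ℤ) : ℤ := if i = r then r + 1 else if i = r + 1 then r else i

/-- The entry at `A.1` can jump to the next place `A.2` with a nonpositive entry. -/
structure Hop (v : ℤ → ℤ) (A : ℤ × ℤ) : Prop where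
  lt : A.1 < A.2
  pos : 0 < v A.1
  nonpos : v A.2 ≤ 0
  between : ∀ i, A.1 < i → i < A.2 → v A.1 < v i

/-- The exchange of the entries at `r` and `r + 1` moves a positive entry past a smaller one. -/
structure Crossing (v : ℤ → ℤ) (r : ℤ) : Prop where
  pos : 0 < v r
  gt : v (r + 1) < v r

/-- `j` is the last place before `r` with a positive entry. -/
structure LastPos (v : ℤ → ℤ) (r j : ℤ) : Prop where
  lt : j < r
  pos : 0 < v j
  nonpos : ∀ i, j < i → i < r → v i ≤ 0

/-- How a hop `A` of `v` and a crossing of `v` at `r` pass each other. -/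
def Pass (v : ℤ → ℤ) (r : ℤ) (A : ℤ × ℤ) (r' : ℤ) (A' : ℤ × ℤ) : Prop :=
  (A.1 ≠ r ∧ r' = r ∧ A' = (sw r A.1, sw r A.2)) ∨
    (A.1 = r ∧ LastPos v r r' ∧ A' = (r', r' + 1))

theorem LastPos.unique {v : ℤ → ℤ} {r j j' : ℤ} (h : LastPos v r j) (h' : LastPos v r j') :
    j = j' := by
  obtain ⟨h1, h2, h3⟩ := h
  obtain ⟨h4, h5, h6⟩ := h'
  by_contra hne
  rcases lt_or_gt_of_ne hne with hl | hl
  · have := h3 _ hl h4; omega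
  · have := h6 _ hl h1; omega

/-- The entry at r + 1 is smaller than the one at r, so it cannot lie strictly inside the hop. Hence
a bumped hop exchanges exactly the strands of the crossing. -/
theorem Hop.tgt_of_crossing {v : ℤ → ℤ} {A : ℤ × ℤ} {r : ℤ} (h : Hop v A) (hr : Crossing v r)
    (he : A.1 = r) : A.2 = r + 1 := by
  obtain ⟨s, t⟩ := A
  obtain ⟨h1, h2, h3, h4⟩ := h
  obtain ⟨h5, h6⟩ := hr
  simp only at *
  subst he
  by_contra hne
  have := h4 (s + 1) (by omega) (by omega)
  omega

theorem Pass.hop {v : ℤ → ℤ} {A A' : ℤ × ℤ} {r r' : ℤ} (h : Hop v A) (hr : Crossing v r)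
    (hp : Pass v r A r' A') : Hop (swp r (r + 1) v) A' := by
  have h0 := h.tgt_of_crossing hr
  obtain ⟨s, t⟩ := A
  obtain ⟨h1, h2, h3, h4⟩ := h
  obtain ⟨h5, h6⟩ := hr
  simp only at *
  rcases hp with ⟨hp, rfl, rfl⟩ | ⟨rfl, ⟨k1, k2, k3⟩, rfl⟩
  · constructor <;> grind [swp, sw]
  · constructor <;> grind [swp, sw]

theorem Pass.crossing {v : ℤ → ℤ} {A A' : ℤ × ℤ} {r r' : ℤ} (h : Hop v A) (hr : Crossing v r)
    (hp : Pass v r A r' A') : Crossing (swp A.1 A.2 v) r' := by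
  have h0 := h.tgt_of_crossing hr
  obtain ⟨s, t⟩ := A
  obtain ⟨h1, h2, h3, h4⟩ := h
  obtain ⟨h5, h6⟩ := hr
  simp only at *
  rcases hp with ⟨hp, rfl, rfl⟩ | ⟨rfl, ⟨k1, k2, k3⟩, rfl⟩
  · constructor <;> grind [swp, sw]
  · constructor <;> grind [swp, sw]

/-- The commuting square of a pass: hop, then new crossing, against old crossing, then new hop. In
the bumping case the hop and the old crossing are the same transposition. -/
theorem Pass.comm {v : ℤ → ℤ} {A A' : ℤ × ℤ} {r r' : ℤ} (h : Hop v A) (hr : Crossing v r)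
    (hp : Pass v r A r' A') :
    swp r' (r' + 1) (swp A.1 A.2 v) = swp A'.1 A'.2 (swp r (r + 1) v) := by
  have h0 := h.tgt_of_crossing hr
  obtain ⟨s, t⟩ := A
  obtain ⟨h1, h2, h3, h4⟩ := h
  simp only at *
  rcases hp with ⟨hp, rfl, rfl⟩ | ⟨rfl, ⟨k1, k2, k3⟩, rfl⟩
  · funext i; grind [swp, sw]
  · funext i; grind [swp, sw]

/-- Together with `Pass.lt_of_lt`, this keeps the relative position of two successive hops while
they rise; these are the order conditions of `Exch.right`. -/
theorem Pass.le_of_le {v : ℤ → ℤ} {A B A' B' : ℤ × ℤ} {r r₁ r₂ : ℤ} (hr : Crossing v r)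
    (hA : Hop v A) (hB : Hop (swp A.1 A.2 v) B) (hAB : B.2 ≤ A.1) (pA : Pass v r A r₁ A')
    (pB : Pass (swp A.1 A.2 v) r₁ B r₂ B') : B'.2 ≤ A'.1 := by
  have h0 := hA.tgt_of_crossing hr
  have h0' := hB.tgt_of_crossing (pA.crossing hA hr)
  obtain ⟨a, a'⟩ := A
  obtain ⟨b, b'⟩ := B
  obtain ⟨h1, h2, h3, h4⟩ := hA
  obtain ⟨m1, m2, m3, m4⟩ := hB
  obtain ⟨h5, h6⟩ := hr
  simp only at *
  have i1 := m4 r₁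
  have i2 := m4 (r₁ + 1)
  rcases pA with ⟨hp, rfl, rfl⟩ | ⟨rfl, ⟨k1, k2, k3⟩, rfl⟩ <;>
  rcases pB with ⟨hq, rfl, rfl⟩ | ⟨rfl, ⟨l1, l2, l3⟩, rfl⟩ <;>
  grind (splits := 30) [swp, sw]

theorem Pass.lt_of_lt {v : ℤ → ℤ} {A C A' C' : ℤ × ℤ} {r r₁ r₂ : ℤ} (hr : Crossing v r)
    (hA : Hop v A) (hC : Hop (swp A.1 A.2 v) C) (hAC : A.1 < C.1) (pA : Pass v r A r₁ A')
    (pC : Pass (swp A.1 A.2 v) r₁ C r₂ C') : A'.1 < C'.1 := by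
  have h0 := hA.tgt_of_crossing hr
  have h0' := hC.tgt_of_crossing (pA.crossing hA hr)
  obtain ⟨a, a'⟩ := A
  obtain ⟨c, c'⟩ := C
  obtain ⟨h1, h2, h3, h4⟩ := hA
  obtain ⟨m1, m2, m3, m4⟩ := hC
  obtain ⟨h5, h6⟩ := hr
  simp only at *
  have i0 := h4 (a + 1)
  rcases pA with ⟨hp, rfl, rfl⟩ | ⟨rfl, ⟨k1, k2, k3⟩, rfl⟩ <;>
  rcases pC with ⟨hq, rfl, rfl⟩ | ⟨rfl, ⟨l1, l2, l3⟩, rfl⟩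
  · grind (splits := 30) [swp, sw]
  · have := l3 (a+1)
    grind (splits := 30) [swp, sw]
  · grind (splits := 30) [swp, sw]
  · grind (splits := 30) [swp, sw]

/-- Hops on different sides of `σ` commute: the right one does not see the left one. -/
theorem Hop.right_of_left {v : ℤ → ℤ} {B C : ℤ × ℤ} (hB : Hop v B) (hC : Hop v C)
    (h : B.2 < C.1) : Hop (swp B.1 B.2 v) C ∧ Hop (swp C.1 C.2 v) B ∧
      swp C.1 C.2 (swp B.1 B.2 v) = swp B.1 B.2 (swp C.1 C.2 v) := by
  obtain ⟨b, b'⟩ := B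
  obtain ⟨c, c'⟩ := C
  obtain ⟨h1, h2, h3, h4⟩ := hB
  obtain ⟨m1, m2, m3, m4⟩ := hC
  simp only at *
  refine ⟨⟨?_, ?_, ?_, ?_⟩, ⟨?_, ?_, ?_, ?_⟩, ?_⟩
  any_goals (simp only; grind [swp])
  funext i; grind [swp]

/-- Once `A` is done, the place `A.1` separates `B` from `C`. Neither hop alters the entries in
which the other would search for a landing place, so the order of passing does not matter. -/
theorem Pass.comm_hops {v : ℤ → ℤ} {A B C A' B' C' B'' C'' : ℤ × ℤ} {r r₁ r₂ r₃ q₂ q₃ : ℤ}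
    (hr : Crossing v r) (hA : Hop v A) (hB : Hop (swp A.1 A.2 v) B) (hC : Hop (swp A.1 A.2 v) C)
    (hAB : B.2 ≤ A.1) (hAC : A.1 < C.1) (pA : Pass v r A r₁ A')
    (pB : Pass (swp A.1 A.2 v) r₁ B r₂ B') (pC : Pass (swp B.1 B.2 (swp A.1 A.2 v)) r₂ C r₃ C')
    (pC' : Pass (swp A.1 A.2 v) r₁ C q₂ C'')
    (pB' : Pass (swp C.1 C.2 (swp A.1 A.2 v)) q₂ B q₃ B'') : r₃ = q₃ ∧ B' = B'' ∧ C' = C'' := by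
  have c1 := pA.crossing hA hr
  obtain ⟨hC2, hB2, -⟩ := hB.right_of_left hC (by omega)
  have hrA := hA.tgt_of_crossing hr
  have hrB := hB.tgt_of_crossing c1
  have hrC := hC.tgt_of_crossing c1
  have c2 := pB.crossing hB c1
  have c2' := pC'.crossing hC c1
  obtain ⟨a, a'⟩ := A
  obtain ⟨b, b'⟩ := B
  obtain ⟨c, c'⟩ := C
  simp only at *
  have i0 := hA.between (a + 1)
  have hA2 := hA.pos
  have hA3 := hA.nonpos
  have hA4 := hA.lt
  have hB1 := hB.lt
  have hC1 := hC.lt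
  have hlow : ∀ i, i ≤ a → swp c c' (swp a a' v) i = swp a a' v i := by
    intro i hi; grind [swp]
  have hhigh : ∀ i, a < i → swp b b' (swp a a' v) i = swp a a' v i := by
    intro i hi; grind [swp]
  have hr0 := hr.pos
  have hr1 := hr.gt
  -- After `A` the place a + 1 carries a positive entry, so a crossing bumped by `C` stops to the
  -- right of a, beyond the reach of `B`.
  have key : c = r₁ → ∀ j, LastPos (swp a a' v) r₁ j ∨ LastPos (swp b b' (swp a a' v)) r₁ j →
      a < j := by
    intro hc j hj
    have ha1 : 0 < swp a a' v (a + 1) := by grind [swp]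
    have ha2 : 0 < swp b b' (swp a a' v) (a + 1) := by rw [hhigh _ (by omega)]; exact ha1
    by_contra hja
    have hne : a + 1 = r₁ := by
      by_contra hne
      rcases hj with hj | hj <;> have := hj.nonpos (a + 1) <;> grind
    rcases pA with ⟨hp, rfl, rfl⟩ | ⟨rfl, hL, rfl⟩
    · have h5 := hA.between (a + 2)
      have := hC.nonpos
      grind [swp]
    · have := hL.lt; omega
  rcases pB with ⟨hq, rfl, rfl⟩ | ⟨rfl, hL, rfl⟩
  · rcases pC' with ⟨hq', rfl, rfl⟩ | ⟨rfl, hL', rfl⟩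
    · rcases pC with ⟨h, rfl, rfl⟩ | ⟨rfl, hL3, rfl⟩
      · rcases pB' with ⟨h, rfl, rfl⟩ | ⟨rfl, hL3, rfl⟩
        · simp
        · simp at hq
      · simp at hq'
    · have hj := key rfl _ (Or.inl hL')
      rcases pC with ⟨h, rfl, rfl⟩ | ⟨-, hL3, rfl⟩
      · simp at h
      · have hj' := key rfl _ (Or.inr hL3)
        have : r₃ = q₂ := by
          refine hL3.unique ⟨hL'.lt, ?_, ?_⟩
          · rw [hhigh _ hj]; exact hL'.pos
          · intro i hi hi'; rw [hhigh _ (by omega)]; exact hL'.nonpos i hi hi'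
        subst this
        have := hL'.lt
        rcases pB' with ⟨h, rfl, rfl⟩ | ⟨rfl, hL4, rfl⟩
        · simp; grind [sw]
        · omega
  · have hb := hL.lt
    rcases pC' with ⟨hq', rfl, rfl⟩ | ⟨rfl, hL', rfl⟩
    · rcases pB' with ⟨h, rfl, rfl⟩ | ⟨-, hL4, rfl⟩
      · simp at h
      · have : q₃ = r₂ := by
          refine hL4.unique ⟨hL.lt, ?_, ?_⟩
          · rw [hlow _ (by omega)]; exact hL.pos
          · intro i hi hi'; rw [hlow _ (by omega)]; exact hL.nonpos i hi hi'
        subst this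
        rcases pC with ⟨h, rfl, rfl⟩ | ⟨rfl, hL3, rfl⟩
        · simp; grind [sw]
        · omega
    · omega

theorem Pass.unique {v : ℤ → ℤ} {r r' r'' : ℤ} {A A' A'' : ℤ × ℤ} (h : Pass v r A r' A')
    (h' : Pass v r A r'' A'') : r' = r'' ∧ A' = A'' := by
  rcases h with ⟨h1, rfl, rfl⟩ | ⟨h1, h2, rfl⟩ <;> rcases h' with ⟨k1, rfl, rfl⟩ | ⟨k1, k2, rfl⟩
  · exact ⟨rfl, rfl⟩
  · exact absurd k1 h1
  · exact absurd h1 k1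
  · obtain rfl := h2.unique k2
    exact ⟨rfl, rfl⟩

/-! ### Exchange of triples of hops and its invariance under a crossing -/

/-- The triples of successive hops of `v` between which the elementary Knuth relation `xzy ~ zxy`
mediates. -/
inductive Exch (v : ℤ → ℤ) : ℤ × ℤ → ℤ × ℤ → ℤ × ℤ → ℤ × ℤ → ℤ × ℤ → ℤ × ℤ → Prop
  | right {A B C : ℤ × ℤ} : Hop v A → Hop (swp A.1 A.2 v) B → Hop (swp A.1 A.2 v) C →
      B.2 ≤ A.1 → A.1 < C.1 → Exch v A C B A B C
  | left {A B C : ℤ × ℤ} : Hop v A → Hop v B → Hop (swp B.1 B.2 (swp A.1 A.2 v)) C →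
      A.2 < B.1 → A.1 < C.1 → C.2 ≤ B.1 → Exch v A B C B A C
  | braid {a b c d : ℤ} : Hop v (a, c) → Hop (swp a c v) (c, d) → Hop v (b, c) →
      a < b → b < c → Exch v (a, c) (c, d) (b, c) (b, c) (a, b) (b, d)

/-- A crossing landing at the last positive place before r lands at j₁ or j₂ according to whether
`A` is done first. The position of j₂ relative to `A` decides which of the three configurations
arises. This serves for a bump at r and also for a crossing newly added at the end of a row. -/
theorem Exch.of_last {v : ℤ → ℤ} {A C C₁ C₂ A₂ : ℤ × ℤ} {r j₁ j₂ r₂ r₃ q₃ : ℤ}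
    (hA : Hop v A) (hAr : A.2 < r) (hvr : v r ≤ 0) (hC : Hop (swp A.1 A.2 v) C)
    (hAC : A.1 < C.1) (hCr : C.2 ≤ r) (h₁ : LastPos (swp A.1 A.2 v) r j₁) (h₂ : LastPos v r j₂)
    (p₁ : Pass (swp A.1 A.2 v) j₁ C r₃ C₁) (p₂ : Pass v j₂ A r₂ A₂)
    (p₃ : Pass (swp A.1 A.2 v) r₂ C q₃ C₂) :
    r₃ = q₃ ∧ Exch v A (j₁, j₁ + 1) C₁ (j₂, j₂ + 1) A₂ C₂ := by
  obtain ⟨a, a'⟩ := A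
  obtain ⟨c, c'⟩ := C
  simp only at *
  have a1 := hA.lt
  have a2 := hA.pos
  have a3 := hA.nonpos
  have a4 := hA.between
  have c1 := hC.lt
  have c2 := hC.pos
  have c3 := hC.nonpos
  have c4 := hC.between
  simp only at *
  have l1 := h₂.lt
  have l2 := h₂.pos
  have l3 := h₂.nonpos
  have hj : a ≤ j₂ := by
    by_contra h
    have := l3 a; omega
  -- If `A` starts at the last positive place, then `A`, the new hop and `C` occupy a, a + 1, a + 2.
  -- The new crossing bumps `A` in one order and `C` in the other, to the same place: configuration
  -- `right`.
  rcases hj.eq_or_lt with rfl | hj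
  · obtain rfl : a' = a + 1 := by
      by_contra h
      have := a4 (a + 1); have := l3 (a + 1); omega
    obtain rfl : j₁ = a + 1 := by
      refine h₁.unique ⟨hAr, ?_, ?_⟩
      · grind [swp]
      · intro i hi hi'; grind [swp]
    obtain rfl : c = a + 1 := by
      by_contra h
      have := h₁.nonpos c; omega
    obtain rfl : c' = a + 2 := by
      by_contra h
      have := c4 (a + 2)
      have := l3 (a + 2)
      grind [swp]
    rcases p₁ with ⟨h, rfl, rfl⟩ | ⟨-, k₁, rfl⟩
    · simp at h
    rcases p₂ with ⟨h, rfl, rfl⟩ | ⟨-, k₂, rfl⟩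
    · simp at h
    have hr : r₂ < a := k₂.lt
    obtain rfl : r₃ = r₂ := by
      refine k₁.unique ⟨by omega, ?_, ?_⟩
      · have := k₂.pos; grind [swp]
      · intro i hi hi'
        have := k₂.nonpos i
        grind [swp]
    rcases p₃ with ⟨h, rfl, rfl⟩ | ⟨h, k₃, rfl⟩
    · refine ⟨rfl, ?_⟩
      have e : (sw q₃ (a + 1), sw q₃ (a + 2)) = (a + 1, a + 2) := by
        grind [sw]
      rw [e, show a + 1 + 1 = a + 2 by ring]
      refine Exch.right hA ⟨?_, ?_, ?_, ?_⟩ hC ?_ ?_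
      · simp
      · have := k₁.pos; simpa using this
      · have := k₁.nonpos (q₃ + 1)
        simp only; grind [swp]
      · simp only; intros; omega
      · simp only; omega
      · simp only; omega
    · omega
  -- If j₂ lies inside `A`, then a' = j₂ + 1 and doing `A` shifts the last positive place to a':
  -- configuration `braid`. Beyond a', `A` does not influence the landing place: configuration
  -- `left`.
  · by_cases hja : j₂ < a'
    · obtain rfl : a' = j₂ + 1 := by
        by_contra h
        have := a4 (j₂ + 1); have := l3 (j₂ + 1); omega
      obtain rfl : j₁ = j₂ + 1 := by
        refine h₁.unique ⟨hAr, ?_, ?_⟩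
        · grind [swp]
        · intro i hi hi'; grind [swp]
      obtain rfl : c = j₂ + 1 := by
        by_contra h
        have i1 := h₁.nonpos c
        have i2 := c4 (j₂ + 1)
        have i3 := a4 c
        have i4 := a4 c'
        grind [swp]
      obtain rfl : c' = j₂ + 2 := by
        by_contra h
        have i1 := c4 (j₂ + 2)
        have i2 := h₁.nonpos (j₂ + 2)
        grind [swp]
      rcases p₁ with ⟨h, rfl, rfl⟩ | ⟨-, k₁, rfl⟩
      · simp at h
      obtain rfl : r₃ = j₂ := by
        refine k₁.unique ⟨by omega, ?_, ?_⟩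
        · grind [swp]
        · intro i hi hi'; omega
      rcases p₂ with ⟨h, rfl, rfl⟩ | ⟨h, k₂, rfl⟩
      swap
      · simp only at h; omega
      rcases p₃ with ⟨h', rfl, rfl⟩ | ⟨h', k₂, rfl⟩
      swap
      · simp only at h'; omega
      refine ⟨rfl, ?_⟩
      have e1 : (sw q₃ a, sw q₃ (q₃ + 1)) = (a, q₃) := by grind [sw]
      have e2 : (sw q₃ (q₃ + 1), sw q₃ (q₃ + 2)) = (q₃, q₃ + 2) := by grind [sw]
      simp only
      rw [e1, e2, show q₃ + 1 + 1 = q₃ + 2 by ring]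
      refine Exch.braid hA hC ⟨?_, l2, a3, ?_⟩ hj ?_
      · simp
      · simp only; intros; omega
      · omega
    · have hja' : a' < j₂ := by
        rcases lt_or_eq_of_le (not_lt.1 hja) with h | h
        · exact h
        · rw [← h] at l2; omega
      obtain rfl : j₁ = j₂ := by
        refine h₁.unique ⟨l1, ?_, ?_⟩
        · grind [swp]
        · intro i hi hi'; grind [swp]
      rcases p₂ with ⟨h, rfl, rfl⟩ | ⟨h, k₂, rfl⟩
      swap
      · simp only at h; omega
      obtain ⟨rfl, rfl⟩ := p₁.unique p₃
      refine ⟨rfl, ?_⟩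
      have e1 : (sw r₂ a, sw r₂ a') = (a, a') := by grind [sw]
      have hcr : Crossing (swp a a' v) r₂ := ⟨h₁.pos, by
        have := h₁.pos
        have := h₁.nonpos (r₂ + 1)
        grind [swp]⟩
      have hC' := p₁.hop hC hcr
      simp only
      rw [e1]
      refine Exch.left hA ⟨?_, l2, ?_, ?_⟩ hC' hja' ?_ ?_
      · simp
      · have := l3 (r₂ + 1)
        simp only; grind
      · simp only; intros; omega
      · rcases p₁ with ⟨h, rfl, rfl⟩ | ⟨h, k, rfl⟩
        · grind [sw]
        · have i1 := k.nonpos a'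
          have i2 := k.lt
          simp only at *; grind [swp]
      · rcases p₁ with ⟨h', rfl, rfl⟩ | ⟨h', k, rfl⟩
        · have i1 := h₁.nonpos c
          have i2 := c4 (r₃ + 1)
          have i3 := h₁.nonpos (r₃ + 1)
          have i4 := h₁.pos
          simp only at *
          grind (splits := 30) [sw, swp]
        · have i2 := k.lt
          simp only at *; omega

theorem swp_comm {v : ℤ → ℤ} {a b c d : ℤ} (h₁ : a ≠ c) (h₂ : a ≠ d) (h₃ : b ≠ c) (h₄ : b ≠ d) :
    swp a b (swp c d v) = swp c d (swp a b v) := by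
  funext i; grind [swp]

/-- Without a bump a configuration is merely transported. `right` is always preserved; a bump of `B`
in `left`, or of the hop from b in `braid`, is where the configuration can change. -/
theorem Exch.pass {v : ℤ → ℤ} {A B C D E F A' B' C' D' E' F' : ℤ × ℤ}
    {r r₁ r₂ r₃ q₁ q₂ q₃ : ℤ} (h : Exch v A B C D E F) (hr : Crossing v r)
    (p₁ : Pass v r A r₁ A') (p₂ : Pass (swp A.1 A.2 v) r₁ B r₂ B')
    (p₃ : Pass (swp B.1 B.2 (swp A.1 A.2 v)) r₂ C r₃ C')
    (p₁' : Pass v r D q₁ D') (p₂' : Pass (swp D.1 D.2 v) q₁ E q₂ E')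
    (p₃' : Pass (swp E.1 E.2 (swp D.1 D.2 v)) q₂ F q₃ F') :
    r₃ = q₃ ∧ Exch (swp r (r + 1) v) A' B' C' D' E' F' := by
  induction h with
  | @right A B C hA hB hC hBA hAC =>
    obtain ⟨rfl, rfl⟩ := p₁.unique p₁'
    obtain ⟨rfl, rfl, rfl⟩ := p₁.comm_hops hr hA hB hC hBA hAC p₂' p₃' p₂ p₃
    refine ⟨rfl, ?_⟩
    have k := p₁.crossing hA hr
    have e := p₁.comm hA hr
    have hB' := p₂'.hop hB k
    have hC' := p₂.hop hC k
    rw [e] at hB' hC'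
    exact .right (p₁.hop hA hr) hB' hC' (p₁.le_of_le hr hA hB hBA p₂') (p₁.lt_of_lt hr hA hC hAC p₂)
  | @left A B C hA hB hC hAB hAC hCB =>
    obtain ⟨hB2, hA2, hw⟩ := hA.right_of_left hB hAB
    have k₁ := p₁.crossing hA hr
    have k₂ := p₂.crossing hB2 k₁
    have e₁ := p₁.comm hA hr
    have e₂ := p₂.comm hB2 k₁
    have hA' := p₁.hop hA hr
    have hB' := p₁'.hop hB hr
    have hC' := p₃.hop hC k₂
    rw [e₂, e₁] at hC'
    have tA := hA.tgt_of_crossing hr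
    have tB := hB.tgt_of_crossing hr
    have a1 := hA.lt
    have b1 := hB.lt
    have c1 := hC.lt
    rw [← hw] at p₃'
    have hr0 := hr.pos
    have hr1 := hr.gt
    have hA3 := hA.nonpos
    have hlow : ∀ i, i < B.1 → swp B.1 B.2 v i = v i := by
      intro i hi; grind [swp]
    by_cases hrA : A.1 = r
    · have tA := tA hrA
      rcases p₁ with ⟨h, -, -⟩ | ⟨-, hL, rfl⟩
      · exact absurd hrA h
      have hl := hL.lt
      rcases p₂ with ⟨-, rfl, rfl⟩ | ⟨h, -, -⟩
      swap
      · omega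
      rcases p₁' with ⟨-, rfl, rfl⟩ | ⟨h, -, -⟩
      swap
      · omega
      rcases p₂' with ⟨h, -, -⟩ | ⟨-, hL', rfl⟩
      · exact absurd hrA h
      obtain rfl : r₂ = q₂ := by
        refine hL.unique ⟨hL'.lt, ?_, ?_⟩
        · have h1 := hL'.lt
          have h2 := hL'.pos
          rwa [hlow _ (by omega)] at h2
        · intro i hi hi'
          have h2 := hL'.nonpos i hi hi'
          rwa [hlow _ (by omega)] at h2
      obtain ⟨rfl, rfl⟩ := p₃.unique p₃'
      refine ⟨rfl, ?_⟩
      have e : (sw q₁ B.1, sw q₁ B.2) = (sw r₂ B.1, sw r₂ B.2) := by grind [sw]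
      rw [e] at hB' ⊢
      refine .left hA' hB' hC' ?_ ?_ ?_
      · grind [sw]
      all_goals
        rcases p₃ with ⟨-, rfl, rfl⟩ | ⟨h, -, -⟩
        · grind [sw]
        · omega
    · rcases p₁ with ⟨-, rfl, rfl⟩ | ⟨h, -, -⟩
      swap
      · exact absurd h hrA
      -- When `B` is bumped, its landing place is searched once with `A` done and once without:
      -- `Exch.of_last` for the word after the crossing.
      by_cases hrB : B.1 = r₁
      · have tB := tB hrB
        rcases p₂ with ⟨h, -, -⟩ | ⟨-, hL, rfl⟩
        · exact absurd hrB h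
        rcases p₁' with ⟨h, -, -⟩ | ⟨-, hL', rfl⟩
        · exact absurd hrB h
        subst hrB
        rw [tB] at p₂' p₃ hlow hC hA2
        have eA : (sw B.1 A.1, sw B.1 A.2) = A := by
          ext <;> grind [sw]
        rw [eA]
        have ew : swp B.1 (B.1 + 1) (swp A.1 A.2 v) = swp A.1 A.2 (swp B.1 (B.1 + 1) v) := by
          apply swp_comm <;> omega
        rw [ew] at hC p₃
        rw [tB, ew] at p₃'
        refine Exch.of_last hA2 hAB ?_ hC hAC hCB ⟨hL.lt, ?_, ?_⟩ ⟨hL'.lt, ?_, ?_⟩ p₃ p₂' p₃'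
        · have := hB.nonpos
          rw [tB] at this
          grind [swp]
        · have := hL.lt
          have := hL.pos
          rw [← ew]
          grind [swp]
        · intro i hi hi'
          have := hL.nonpos i hi hi'
          rw [← ew]
          grind [swp]
        · have := hL'.lt
          have := hL'.pos
          grind [swp]
        · intro i hi hi'
          have := hL'.nonpos i hi hi'
          grind [swp]
      · rcases p₂ with ⟨-, rfl, rfl⟩ | ⟨h, -, -⟩
        swap
        · exact absurd h hrB
        rcases p₁' with ⟨-, rfl, rfl⟩ | ⟨h, -, -⟩
        swap
        · exact absurd h hrB
        rcases p₂' with ⟨-, rfl, rfl⟩ | ⟨h, -, -⟩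
        swap
        · exact absurd h hrA
        obtain ⟨rfl, rfl⟩ := p₃.unique p₃'
        refine ⟨rfl, ?_⟩
        refine .left hA' hB' hC' ?_ ?_ ?_
        · grind [sw]
        · rcases p₃ with ⟨-, rfl, rfl⟩ | ⟨h, hL, rfl⟩
          · have hr2 := k₂.pos
            grind [sw, swp]
          · have i1 := hA.between (A.1 + 1)
            have i2 := hA.between (A.1 + 2)
            have i3 := hL.nonpos (A.1 + 1)
            have i4 := hL.pos
            have i5 := hC.tgt_of_crossing k₂ h
            have i6 := hC.nonpos
            have i7 := hA.pos
            grind (splits := 30) [sw, swp]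
        · rcases p₃ with ⟨-, rfl, rfl⟩ | ⟨h, hL, rfl⟩
          · have hr2 := k₂.pos
            have hC3 := hC.nonpos
            by_cases hCr : C.2 = r₃
            · rw [hCr] at hC3; omega
            · grind [sw]
          · have i5 := hC.tgt_of_crossing k₂ h
            have i6 := hL.lt
            grind [sw]
  | @braid a b c d hA hB hD hab hbc =>
    simp only at *
    have k₁ := p₁.crossing hA hr
    have k₂ := p₂.crossing hB k₁
    have e₁ := p₁.comm hA hr
    have hA' := p₁.hop hA hr
    have hB' := p₂.hop hB k₁
    have hD' := p₁'.hop hD hr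
    rw [e₁] at hB'
    have a4 := hA.between
    have d3 := hD.nonpos
    have tD := hD.tgt_of_crossing hr
    have hB1 := hB.lt
    have a2 := hA.pos
    simp only at *
    have hr0 := hr.pos
    have hr1 := hr.gt
    have hra : a ≠ r := by
      rintro rfl
      have := a4 (a + 1); omega
    have hrc : c ≠ r := by
      rintro rfl; omega
    rcases p₁ with ⟨-, rfl, rfl⟩ | ⟨h, -, -⟩
    swap
    · exact absurd h hra
    rcases p₂ with ⟨-, rfl, rfl⟩ | ⟨h, -, -⟩
    swap
    · exact absurd h hrc
    simp only at *
    -- Only the hop from b can be bumped. If a = b - 1, one order lands at a and is then bumped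
    -- again by the hop (a, b), whereas the other skips a, where the entry is already nonpositive:
    -- both reach the same place, and the result is `right`. Otherwise b - 1 is positive, being
    -- inside the hop (a, c), and `braid` persists.
    by_cases hbr : b = r₂
    · subst hbr
      obtain rfl := tD rfl
      rcases p₃ with ⟨h, -, -⟩ | ⟨-, hL, rfl⟩
      · exact absurd rfl h
      rcases p₁' with ⟨h, -, -⟩ | ⟨-, hL', rfl⟩
      · exact absurd rfl h
      simp only at *
      have hl := hL.lt
      have hl' := hL'.lt
      have s1 : sw b a = a := by grind [sw]
      have s2 : sw b (b + 1) = b := by grind [sw]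
      have s3 : sw b d = d := by grind [sw]
      rw [s1, s2] at hA' hB' ⊢
      rw [s3] at hB' ⊢
      have hv2 : ∀ i, a < i → i < b → swp (b + 1) d (swp a (b + 1) v) i = v i := by
        intro i hi; grind [swp]
      by_cases hab' : a = b - 1
      · obtain rfl : q₁ = a := hL'.unique ⟨by omega, a2, by intros; omega⟩
        have hc3 : swp (b + 1) d (swp q₁ (b + 1) v) q₁ ≤ 0 := by grind [swp]
        have hr3 : r₃ < q₁ := by
          by_contra h
          have := hL.pos
          obtain rfl : r₃ = q₁ := by omega
          omega
        rcases p₂' with ⟨h, -, -⟩ | ⟨-, hM, rfl⟩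
        · exact absurd rfl h
        obtain rfl : r₃ = q₂ := by
          refine LastPos.unique (r := q₁) ⟨hr3, ?_, ?_⟩ ⟨hM.lt, ?_, ?_⟩ (v := v)
          · have := hL.pos; grind [swp]
          · intro i hi hi'
            have := hL.nonpos i hi (by omega); grind [swp]
          · have := hM.lt; have := hM.pos; grind [swp]
          · intro i hi hi'
            have := hM.nonpos i hi hi'; grind [swp]
        rcases p₃' with ⟨-, rfl, rfl⟩ | ⟨h, -, -⟩
        swap
        · simp only at h; omega
        refine ⟨rfl, ?_⟩
        have s4 : sw q₃ b = b := by grind [sw]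
        have s5 : sw q₃ d = d := by grind [sw]
        simp only
        rw [s4, s5, show q₁ + 1 = b by omega]
        refine .right hA' ⟨?_, ?_, ?_, ?_⟩ hB' ?_ ?_
        · simp
        · have := hL.pos
          simp only; grind [swp]
        · have := hL.nonpos (q₃ + 1)
          simp only; grind [swp]
        all_goals (simp only; intros; omega)
      · have ha := a4 (b - 1)
        obtain rfl : q₁ = b - 1 := hL'.unique ⟨by omega, by omega, by intros; omega⟩
        obtain rfl : r₃ = b - 1 := by
          refine hL.unique ⟨by omega, ?_, by intros; omega⟩
          rw [hv2 _ (by omega) (by omega)]; omega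
        rcases p₂' with ⟨-, rfl, rfl⟩ | ⟨h, -, -⟩
        swap
        · simp only at h; omega
        rcases p₃' with ⟨-, rfl, rfl⟩ | ⟨h, -, -⟩
        swap
        · simp only at h; omega
        refine ⟨rfl, ?_⟩
        have s4 : sw (b - 1) a = a := by grind [sw]
        have s5 : sw (b - 1) b = b - 1 := by grind [sw]
        have s6 : sw (b - 1) d = d := by grind [sw]
        rw [show b - 1 + 1 = b by ring] at hD' ⊢
        simp only
        rw [s4, s5, s6]
        exact .braid hA' hB' hD' (by omega) (by omega)
    · rcases p₃ with ⟨-, rfl, rfl⟩ | ⟨h, -, -⟩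
      swap
      · exact absurd h hbr
      rcases p₁' with ⟨-, rfl, rfl⟩ | ⟨h, -, -⟩
      swap
      · exact absurd h hbr
      rcases p₂' with ⟨-, rfl, rfl⟩ | ⟨h, -, -⟩
      swap
      · exact absurd h hra
      rcases p₃' with ⟨-, rfl, rfl⟩ | ⟨h, -, -⟩
      swap
      · exact absurd h hbr
      refine ⟨rfl, ?_⟩
      refine .braid hA' hB' hD' ?_ ?_ <;> grind [sw]

/-! ### Passing the crossings of a whole row -/

theorem LastPos.exists {v : ℤ → ℤ} {p r : ℤ} (hp : 0 < v p) (h : p < r) :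
    ∃ j, p ≤ j ∧ LastPos v r j := by
  obtain ⟨j, ⟨hj, hj'⟩, hm⟩ := Int.exists_greatest_of_bdd (P := fun j => 0 < v j ∧ j < r)
    ⟨r, fun z hz => hz.2.le⟩ ⟨p, hp, h⟩
  refine ⟨j, hm p ⟨hp, h⟩, hj', hj, fun i hi hi' => ?_⟩
  by_contra hc
  have := hm i ⟨by omega, hi'⟩
  omega

/-- The word obtained from `v` by the crossings in `l`, from the first to the last. -/
def run (v : ℤ → ℤ) (l : List ℤ) : ℤ → ℤ := l.foldl (fun v r => swp r (r + 1) v) v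

@[simp] theorem run_nil (v : ℤ → ℤ) : run v [] = v := rfl

@[simp] theorem run_cons (v : ℤ → ℤ) (r : ℤ) (l : List ℤ) :
    run v (r :: l) = run (swp r (r + 1) v) l := rfl

@[simp] theorem run_append (v : ℤ → ℤ) (l l' : List ℤ) : run v (l ++ l') = run (run v l) l' := by
  simp [run]

/-- Every crossing in the list moves a positive entry past a smaller one. -/
def RowOK : (ℤ → ℤ) → List ℤ → Prop
  | _, [] => True
  | v, r :: l => Crossing v r ∧ RowOK (swp r (r + 1) v) l

@[simp] theorem rowOK_nil (v : ℤ → ℤ) : RowOK v [] := trivial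

@[simp] theorem rowOK_cons (v : ℤ → ℤ) (r : ℤ) (l : List ℤ) :
    RowOK v (r :: l) ↔ Crossing v r ∧ RowOK (swp r (r + 1) v) l := Iff.rfl

theorem rowOK_append (v : ℤ → ℤ) (l l' : List ℤ) :
    RowOK v (l ++ l') ↔ RowOK v l ∧ RowOK (run v l) l' := by
  induction l generalizing v with
  | nil => simp
  | cons r l ih => simp [ih, and_assoc]

/-- How a hop passes all the crossings in a list. -/
inductive RowPass : (ℤ → ℤ) → List ℤ → ℤ × ℤ → List ℤ → ℤ × ℤ → Prop
  | nil {v : ℤ → ℤ} {A : ℤ × ℤ} : RowPass v [] A [] A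
  | cons {v : ℤ → ℤ} {r r' : ℤ} {l l' : List ℤ} {A A' A'' : ℤ × ℤ} : Pass v r A r' A' →
      RowPass (swp r (r + 1) v) l A' l' A'' → RowPass v (r :: l) A (r' :: l') A''

theorem RowPass.unique {v : ℤ → ℤ} {l l' l'' : List ℤ} {A A' A'' : ℤ × ℤ}
    (h : RowPass v l A l' A') (h' : RowPass v l A l'' A'') : l' = l'' ∧ A' = A'' := by
  induction h generalizing l'' A'' with
  | nil => cases h'; exact ⟨rfl, rfl⟩
  | cons p _ ih =>
    cases h' with
    | cons q k =>
      obtain ⟨rfl, rfl⟩ := p.unique q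
      obtain ⟨rfl, rfl⟩ := ih k
      exact ⟨rfl, rfl⟩

theorem RowPass.hop {v : ℤ → ℤ} {l l' : List ℤ} {A A' : ℤ × ℤ} (h : RowPass v l A l' A')
    (hA : Hop v A) (hl : RowOK v l) : Hop (run v l) A' := by
  induction h with
  | nil => exact hA
  | cons p _ ih => exact ih (p.hop hA hl.1) hl.2

theorem RowPass.run_eq {v : ℤ → ℤ} {l l' : List ℤ} {A A' : ℤ × ℤ} (h : RowPass v l A l' A')
    (hA : Hop v A) (hl : RowOK v l) : run (swp A.1 A.2 v) l' = swp A'.1 A'.2 (run v l) := by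
  induction h with
  | nil => rfl
  | cons p _ ih =>
    rw [run_cons, p.comm hA hl.1]
    exact ih (p.hop hA hl.1) hl.2

theorem RowPass.rowOK {v : ℤ → ℤ} {l l' : List ℤ} {A A' : ℤ × ℤ} (h : RowPass v l A l' A')
    (hA : Hop v A) (hl : RowOK v l) : RowOK (swp A.1 A.2 v) l' := by
  induction h with
  | nil => trivial
  | cons p _ ih =>
    refine ⟨p.crossing hA hl.1, ?_⟩
    rw [p.comm hA hl.1]
    exact ih (p.hop hA hl.1) hl.2

theorem rowPass_append {v : ℤ → ℤ} {l₁ l₂ l' : List ℤ} {A A' : ℤ × ℤ} :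
    RowPass v (l₁ ++ l₂) A l' A' ↔ ∃ l₁' l₂' B, l' = l₁' ++ l₂' ∧ RowPass v l₁ A l₁' B ∧
      RowPass (run v l₁) l₂ B l₂' A' := by
  induction l₁ generalizing v A l' with
  | nil =>
    constructor
    · intro h
      exact ⟨[], l', A, rfl, .nil, h⟩
    · rintro ⟨_, _, _, rfl, h, h'⟩
      cases h
      exact h'
  | cons r l ih =>
    constructor
    · rintro (_ | ⟨p, h⟩)
      obtain ⟨l₁', l₂', B, rfl, h1, h2⟩ := ih.1 h
      exact ⟨_ :: l₁', l₂', B, rfl, .cons p h1, h2⟩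
    · rintro ⟨_, _, _, rfl, h, h'⟩
      cases h with
      | cons p h => exact .cons p (ih.2 ⟨_, _, _, rfl, h, h'⟩)

theorem rowPass_singleton {v : ℤ → ℤ} {r : ℤ} {l' : List ℤ} {A A' : ℤ × ℤ} :
    RowPass v [r] A l' A' ↔ ∃ r', l' = [r'] ∧ Pass v r A r' A' := by
  constructor
  · rintro (_ | ⟨p, h⟩)
    cases h
    exact ⟨_, rfl, p⟩
  · rintro ⟨r', rfl, p⟩
    exact .cons p .nil

/-- Here p is the preceding crossing, or a sentinel left of the row, and p' its new position. The
positive entry at p + 1 stops the leftward search, so a bumped crossing stays to the right of its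
predecessor and the new row is again increasing. -/
theorem RowPass.exists {l : List ℤ} : ∀ {v : ℤ → ℤ} {p p' : ℤ} {A : ℤ × ℤ},
    (p :: l).Pairwise (· < ·) → 0 < v (p + 1) → A.1 ≠ p + 1 → p' ≤ p → Hop v A → RowOK v l →
    ∃ l' A', RowPass v l A l' A' ∧ (p' :: l').Pairwise (· < ·) := by
  induction l with
  | nil => intro v p p' A _ _ _ _ _ _; exact ⟨[], A, .nil, by simp⟩
  | cons r l ih =>
    intro v p p' A hs hp hA hp' h hl
    have hpr : p < r := by simp at hs; omega
    have hrl : (r :: l).Pairwise (· < ·) := (List.pairwise_cons.1 hs).2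
    have hr0 : 0 < swp r (r + 1) v (r + 1) := by
      have := hl.1.pos; simpa [swp] using this
    by_cases hAr : A.1 = r
    · obtain ⟨j, hj, hL⟩ := LastPos.exists (r := r) hp (by omega)
      have hpass : Pass v r A j (j, j + 1) := Or.inr ⟨hAr, hL, rfl⟩
      have hlt := hL.lt
      obtain ⟨l', A', h1, h2⟩ := ih (p' := j) hrl hr0 (by simp only; omega) hL.lt.le
        (hpass.hop h hl.1) hl.2
      refine ⟨j :: l', A', .cons hpass h1, List.pairwise_cons.2 ⟨?_, h2⟩⟩
      intro a ha
      rcases List.mem_cons.1 ha with rfl | ha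
      · omega
      · have := (List.pairwise_cons.1 h2).1 a ha
        omega
    · have hpass : Pass v r A r (sw r A.1, sw r A.2) := Or.inl ⟨hAr, rfl, rfl⟩
      obtain ⟨l', A', h1, h2⟩ := ih (p' := r) hrl hr0 (by simp only [sw]; split_ifs <;> omega) le_rfl
        (hpass.hop h hl.1) hl.2
      refine ⟨r :: l', A', .cons hpass h1, List.pairwise_cons.2 ⟨?_, h2⟩⟩
      intro a ha
      rcases List.mem_cons.1 ha with rfl | ha
      · omega
      · have := (List.pairwise_cons.1 h2).1 a ha
        omega

theorem RowPass.eq_of_lt {v : ℤ → ℤ} {l l' : List ℤ} {A A' : ℤ × ℤ} (h : RowPass v l A l' A')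
    (hA : A.1 < A.2) (hl : ∀ r ∈ l, A.2 < r) : l' = l ∧ A' = A := by
  induction h with
  | nil => exact ⟨rfl, rfl⟩
  | @cons v r r' l l' A A' A'' p _ ih =>
    have hr := hl r (by simp)
    rcases p with ⟨-, rfl, rfl⟩ | ⟨h, -, -⟩
    swap
    · omega
    have e : (sw r' A.1, sw r' A.2) = A := by ext <;> grind [sw]
    rw [e] at ih
    obtain ⟨rfl, rfl⟩ := ih hA (fun x hx => hl x (by simp [hx]))
    exact ⟨rfl, rfl⟩

theorem swp_sw (v : ℤ → ℤ) (r i : ℤ) : swp r (r + 1) v (sw r i) = v i := by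
  grind [swp, sw]

/-- A row bumps at most once: after a bump at r the hop ends at r or before, and the remaining
crossings of the row lie further right. In the first alternative the hop keeps its two strands. -/
theorem RowPass.same_or_bump {v : ℤ → ℤ} {l l' : List ℤ} {A A' : ℤ × ℤ}
    (h : RowPass v l A l' A') (hA : Hop v A) (hl : RowOK v l) (hs : l.Pairwise (· < ·)) :
    (l' = l ∧ run v l A'.1 = v A.1 ∧ run v l A'.2 = v A.2) ∨
      ∃ l₁ r l₂ j, l = l₁ ++ r :: l₂ ∧ l' = l₁ ++ j :: l₂ ∧ run v l₁ r = v A.1 ∧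
        run v l₁ (r + 1) = v A.2 ∧ LastPos (run v l₁) r j ∧ A' = (j, j + 1) := by
  induction h with
  | nil => exact Or.inl ⟨rfl, rfl, rfl⟩
  | @cons v r r' l l' A A' A'' p h ih =>
    have hs' := List.pairwise_cons.1 hs
    have t := hA.tgt_of_crossing hl.1
    have hA' := p.hop hA hl.1
    rcases p with ⟨-, rfl, rfl⟩ | ⟨rfl, hL, rfl⟩
    · rcases ih hA' hl.2 hs'.2 with ⟨rfl, h1, h2⟩ | ⟨l₁, r, l₂, j, rfl, rfl, h1, h2, h3, rfl⟩
      · left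
        simp only [swp_sw] at h1 h2
        exact ⟨rfl, h1, h2⟩
      · right
        simp only [swp_sw] at h1 h2
        exact ⟨r' :: l₁, r, l₂, j, rfl, rfl, h1, h2, h3, rfl⟩
    · right
      have hlt := hL.lt
      obtain ⟨rfl, rfl⟩ := h.eq_of_lt (by simp) (fun x hx => by have := hs'.1 x hx; simp only; omega)
      exact ⟨[], A.1, l', r', rfl, rfl, rfl, by rw [← t rfl]; rfl, hL, rfl⟩

/-- Each crossing leaves a positive entry just to its right. Hence the last positive place lies
beyond the whole row, and an inserted crossing goes to the end of its row. -/
theorem run_pos_after {l : List ℤ} : ∀ {v : ℤ → ℤ} {p : ℤ}, (p :: l).Pairwise (· < ·) →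
    0 < v (p + 1) → RowOK v l → ∃ q, p ≤ q ∧ (∀ r ∈ l, r ≤ q) ∧ 0 < run v l (q + 1) := by
  induction l with
  | nil => intro v p _ h _; exact ⟨p, le_rfl, by simp, h⟩
  | cons r l ih =>
    intro v p hs _ hl
    have hs' := List.pairwise_cons.1 hs
    have hpr := hs'.1 r (by simp)
    obtain ⟨q, h1, h2, h3⟩ := ih hs'.2 (by have := hl.1.pos; simpa [swp] using this) hl.2
    refine ⟨q, by omega, fun x hx => ?_, h3⟩
    rcases List.mem_cons.1 hx with rfl | hx
    · exact h1
    · exact h2 x hx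

theorem RowPass.le_of_le {l : List ℤ} : ∀ {v : ℤ → ℤ} {l₁ l₂ : List ℤ} {A B A' B' : ℤ × ℤ},
    RowOK v l → Hop v A → Hop (swp A.1 A.2 v) B → B.2 ≤ A.1 → RowPass v l A l₁ A' →
    RowPass (swp A.1 A.2 v) l₁ B l₂ B' → B'.2 ≤ A'.1 := by
  induction l with
  | nil => rintro v l₁ l₂ A B A' B' - - - h (_ | _) (_ | _); exact h
  | cons r l ih =>
    rintro v l₁ l₂ A B A' B' hl hA hB h (_ | ⟨p, pp⟩) (_ | ⟨q, qq⟩)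
    have hB' := q.hop hB (p.crossing hA hl.1)
    rw [p.comm hA hl.1] at qq hB'
    exact ih hl.2 (p.hop hA hl.1) hB' (p.le_of_le hl.1 hA hB h q) pp qq

theorem RowPass.lt_of_lt {l : List ℤ} : ∀ {v : ℤ → ℤ} {l₁ l₂ : List ℤ} {A B A' B' : ℤ × ℤ},
    RowOK v l → Hop v A → Hop (swp A.1 A.2 v) B → A.1 < B.1 → RowPass v l A l₁ A' →
    RowPass (swp A.1 A.2 v) l₁ B l₂ B' → A'.1 < B'.1 := by
  induction l with
  | nil => rintro v l₁ l₂ A B A' B' - - - h (_ | _) (_ | _); exact h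
  | cons r l ih =>
    rintro v l₁ l₂ A B A' B' hl hA hB h (_ | ⟨p, pp⟩) (_ | ⟨q, qq⟩)
    have hB' := q.hop hB (p.crossing hA hl.1)
    rw [p.comm hA hl.1] at qq hB'
    exact ih hl.2 (p.hop hA hl.1) hB' (p.lt_of_lt hl.1 hA hB h q) pp qq

theorem Exch.hops {v : ℤ → ℤ} {A B C D E F : ℤ × ℤ} (h : Exch v A B C D E F) :
    (Hop v A ∧ Hop (swp A.1 A.2 v) B) ∧ Hop v D ∧ Hop (swp D.1 D.2 v) E := by
  induction h with
  | right hA hB hC _ _ => exact ⟨⟨hA, hC⟩, hA, hB⟩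
  | left hA hB _ hAB _ _ =>
    obtain ⟨h1, h2, -⟩ := hA.right_of_left hB hAB
    exact ⟨⟨hA, h1⟩, hB, h2⟩
  | braid hA hB hD hab hbc =>
    refine ⟨⟨hA, hB⟩, hD, ?_⟩
    have a2 := hA.pos
    have a4 := hA.between
    have d3 := hD.nonpos
    constructor <;> simp only at * <;> grind [swp]

/-- Iterates `Exch.pass` along the row; the commuting squares rewrite the words reached by the hops
into words after the first crossing. -/
theorem RowPass.exch {l : List ℤ} : ∀ {v : ℤ → ℤ} {A B C D E F A' B' C' D' E' F' : ℤ × ℤ}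
    {l₁ l₂ l₃ m₁ m₂ m₃ : List ℤ}, Exch v A B C D E F → RowOK v l → RowPass v l A l₁ A' →
    RowPass (swp A.1 A.2 v) l₁ B l₂ B' → RowPass (swp B.1 B.2 (swp A.1 A.2 v)) l₂ C l₃ C' →
    RowPass v l D m₁ D' → RowPass (swp D.1 D.2 v) m₁ E m₂ E' →
    RowPass (swp E.1 E.2 (swp D.1 D.2 v)) m₂ F m₃ F' →
    l₃ = m₃ ∧ Exch (run v l) A' B' C' D' E' F' := by
  induction l with
  | nil =>
    rintro v A B C D E F A' B' C' D' E' F' l₁ l₂ l₃ m₁ m₂ m₃ h - (_ | _) (_ | _) (_ | _) (_ | _)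
      (_ | _) (_ | _)
    exact ⟨rfl, h⟩
  | cons r l ih =>
    rintro v A B C D E F A' B' C' D' E' F' l₁ l₂ l₃ m₁ m₂ m₃ h hl (_ | ⟨p₁, k₁⟩) (_ | ⟨p₂, k₂⟩)
      (_ | ⟨p₃, k₃⟩) (_ | ⟨q₁, n₁⟩) (_ | ⟨q₂, n₂⟩) (_ | ⟨q₃, n₃⟩)
    obtain ⟨⟨hA, hB⟩, hD, hE⟩ := h.hops
    obtain ⟨rfl, h'⟩ := h.pass hl.1 p₁ p₂ p₃ q₁ q₂ q₃
    rw [p₂.comm hB (p₁.crossing hA hl.1), p₁.comm hA hl.1] at k₃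
    rw [p₁.comm hA hl.1] at k₂
    rw [q₂.comm hE (q₁.crossing hD hl.1), q₁.comm hD hl.1] at n₃
    rw [q₁.comm hD hl.1] at n₂
    obtain ⟨rfl, h''⟩ := ih h' hl.2 k₁ k₂ k₃ n₁ n₂ n₃
    exact ⟨rfl, h''⟩

/-! ### Insertion in terms of rows, and the two Knuth relations -/

/-- The word after the first `m` rows of `ρ`. -/
def wordNat (ρ : ℤ → List ℤ) : ℕ → ℤ → ℤ
  | 0 => fun q => -q
  | m + 1 => run (wordNat ρ m) (ρ (m + 1))

/-- The word after the rows of `ρ` up to the row `k`. -/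
def word (ρ : ℤ → List ℤ) (k : ℤ) : ℤ → ℤ := wordNat ρ k.toNat

theorem word_of_nonpos (ρ : ℤ → List ℤ) {k : ℤ} (hk : k ≤ 0) : word ρ k = fun q => -q := by
  simp [word, Int.toNat_of_nonpos hk, wordNat]

theorem word_of_pos (ρ : ℤ → List ℤ) {k : ℤ} (hk : 0 < k) :
    word ρ k = run (word ρ (k - 1)) (ρ k) := by
  obtain ⟨m, rfl⟩ : ∃ m : ℕ, k = m + 1 := ⟨(k - 1).toNat, by omega⟩
  have h1 : ((m : ℤ) + 1).toNat = m + 1 := by omega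
  simp [word, h1, wordNat]

theorem word_congr {ρ ρ' : ℤ → List ℤ} {k : ℤ} (h : ∀ i, 0 < i → i ≤ k → ρ' i = ρ i) :
    word ρ' k = word ρ k := by
  have key : ∀ m : ℕ, (m : ℤ) ≤ k ∨ m = 0 → wordNat ρ' m = wordNat ρ m := by
    intro m
    induction m with
    | zero => intro _; rfl
    | succ m ih =>
      intro hm
      simp only [wordNat]
      rw [ih (by omega), h _ (by omega) (by omega)]
  exact key _ (by omega)

/-- Every crossing in the rows of `ρ` moves a positive entry past a smaller one. -/
def Good (ρ : ℤ → List ℤ) : Prop := ∀ k, 0 < k → RowOK (word ρ (k - 1)) (ρ k)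

/-- `j` is the last place with a positive entry. -/
def IsLast (v : ℤ → ℤ) (j : ℤ) : Prop := 0 < v j ∧ ∀ i, j < i → v i ≤ 0

theorem IsLast.unique {v : ℤ → ℤ} {i j : ℤ} (h : IsLast v i) (h' : IsLast v j) : i = j := by
  by_contra hne
  rcases lt_or_gt_of_ne hne with hl | hl
  · have := h.2 _ hl; have := h'.1; omega
  · have := h'.2 _ hl; have := h.1; omega

theorem IsLast.lastPos {v : ℤ → ℤ} {j r : ℤ} (h : IsLast v j) (hr : j < r) : LastPos v r j :=
  ⟨hr, h.1, fun i hi _ => h.2 i hi⟩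

theorem IsLast.hop {v : ℤ → ℤ} {j : ℤ} (h : IsLast v j) : Hop v (j, j + 1) :=
  ⟨by simp, h.1, h.2 _ (by simp), by simp only; intros; omega⟩

theorem IsLast.crossing {v : ℤ → ℤ} {j : ℤ} (h : IsLast v j) : Crossing v j :=
  ⟨h.1, (h.2 _ (by simp)).trans_lt h.1⟩

/-- After the hop the place `A.1` + 1 is positive: it is either inside the hop or its target, which
has received the positive entry. -/
theorem Hop.lt_of_isLast {v : ℤ → ℤ} {A : ℤ × ℤ} {j : ℤ} (h : Hop v A)
    (hj : IsLast (swp A.1 A.2 v) j) : A.1 < j := by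
  by_contra hc
  have h1 := hj.2 (A.1 + 1) (by omega)
  have h2 := h.between (A.1 + 1) (by omega)
  have h3 := h.pos
  have h4 := h.lt
  grind [swp]

/-- The insertion of `x` into the table with the rows `ρ` gives the rows `ρ'`: a new crossing at the
end of the row `x` starts a hop, which passes the rows above and becomes `σ k` after the row `k`. -/
structure InsRows (ρ : ℤ → List ℤ) (x : ℤ) (ρ' : ℤ → List ℤ) (σ : ℤ → ℤ × ℤ) : Prop where
  below : ∀ k, k < x → ρ' k = ρ k
  row : ρ' x = ρ x ++ [(σ x).1]
  snd : (σ x).2 = (σ x).1 + 1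
  last : IsLast (word ρ x) (σ x).1
  above : ∀ k, x < k → RowPass (word ρ (k - 1)) (ρ k) (σ (k - 1)) (ρ' k) (σ k)

section
variable {ρ ρ' ρ₁ ρ₂ ρ₃ μ₁ μ₂ μ₃ : ℤ → List ℤ} {σ σ₁ σ₂ σ₃ τ₁ τ₂ τ₃ : ℤ → ℤ × ℤ} {x y z k : ℤ}

theorem InsRows.word_below (h : InsRows ρ x ρ' σ) (hk : k < x) : word ρ' k = word ρ k :=
  word_congr fun i _ hi => h.below i (by omega)

theorem InsRows.fst (h : InsRows ρ x ρ' σ) : σ x = ((σ x).1, (σ x).1 + 1) := by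
  ext
  · rfl
  · exact h.snd

theorem InsRows.hop_word (h : InsRows ρ x ρ' σ) (hρ : Good ρ) (hx : 0 < x) (hk : x ≤ k) :
    Hop (word ρ k) (σ k) ∧ word ρ' k = swp (σ k).1 (σ k).2 (word ρ k) := by
  induction k, hk using Int.leInduction with
  | base =>
    refine ⟨by rw [h.fst]; exact h.last.hop, ?_⟩
    rw [word_of_pos ρ' hx, h.row, run_append, h.word_below (by omega), ← word_of_pos ρ hx, h.snd]
    rfl
  | succ k hk ih =>
    have hk' : 0 < k + 1 := by omega
    have hp := h.above (k + 1) (by omega)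
    have hok := hρ _ hk'
    rw [add_sub_cancel_right] at hp hok
    rw [word_of_pos ρ hk', word_of_pos ρ' hk', add_sub_cancel_right, ih.2]
    exact ⟨hp.hop ih.1 hok, hp.run_eq ih.1 hok⟩

theorem InsRows.hop (h : InsRows ρ x ρ' σ) (hρ : Good ρ) (hx : 0 < x) (hk : x ≤ k) :
    Hop (word ρ k) (σ k) := (h.hop_word hρ hx hk).1

theorem InsRows.word_eq (h : InsRows ρ x ρ' σ) (hρ : Good ρ) (hx : 0 < x) (hk : x ≤ k) :
    word ρ' k = swp (σ k).1 (σ k).2 (word ρ k) := (h.hop_word hρ hx hk).2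

theorem InsRows.good (h : InsRows ρ x ρ' σ) (hρ : Good ρ) (hx : 0 < x) : Good ρ' := by
  intro k hk
  rcases lt_trichotomy k x with hkx | rfl | hkx
  · rw [h.below k hkx, h.word_below (by omega)]
    exact hρ k hk
  · rw [h.row, h.word_below (by omega), rowOK_append, ← word_of_pos ρ hk]
    exact ⟨hρ k hk, h.last.crossing, trivial⟩
  · rw [h.word_eq hρ hx (by omega)]
    exact (h.above k hkx).rowOK (h.hop hρ hx (by omega)) (hρ k hk)

/-- Insertions into tables that agree up to the row `k` agree up to the row `k`. -/
theorem InsRows.eq_of_agree (h : InsRows ρ x ρ₁ σ) (h' : InsRows ρ' x ρ₂ τ₁)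
    (hw : ∀ i, i ≤ k → ρ' i = ρ i) : (∀ i, i ≤ k → ρ₂ i = ρ₁ i) ∧
      ∀ i, x ≤ i → i ≤ k → τ₁ i = σ i := by
  have hword : ∀ i, i ≤ k → word ρ' i = word ρ i := fun i hi =>
    word_congr fun j _ hj => hw j (by omega)
  have key : ∀ i, x ≤ i → i ≤ k → ρ₂ i = ρ₁ i ∧ τ₁ i = σ i := by
    intro i hi
    induction i, hi using Int.leInduction with
    | base =>
      intro hk
      have hl := h'.last
      rw [hword x hk] at hl
      have e := hl.unique h.last
      refine ⟨?_, ?_⟩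
      · rw [h.row, h'.row, hw x hk, e]
      · rw [h.fst, h'.fst, e]
    | succ i hi ih =>
      intro hk
      have e := (ih (by omega)).2
      have p := h.above (i + 1) (by omega)
      have p' := h'.above (i + 1) (by omega)
      rw [hword _ (by omega), hw _ hk, add_sub_cancel_right, e] at p'
      rw [add_sub_cancel_right] at p
      exact p'.unique p
  refine ⟨fun i hi => ?_, fun i hi hik => (key i hi hik).2⟩
  rcases lt_or_ge i x with hix | hix
  · rw [h.below i hix, h'.below i hix, hw i hi]
  · exact (key i hix hi).1

theorem InsRows.rows_eq_of_exch (hρ : Good ρ) (hx : 0 < x) (hy : 0 < y) {a b c x' : ℤ}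
    (ha' : 0 < a) (hb' : 0 < b) (hxz : x ≤ z) (hyz : y ≤ z) (hxz' : x' ≤ z) (ha : a ≤ z)
    (hb : b ≤ z) (hc : c ≤ z)
    (h₁ : InsRows ρ x ρ₁ σ₁) (h₂ : InsRows ρ₁ y ρ₂ σ₂) (h₃ : InsRows ρ₂ x' ρ₃ σ₃)
    (k₁ : InsRows ρ a μ₁ τ₁) (k₂ : InsRows μ₁ b μ₂ τ₂) (k₃ : InsRows μ₂ c μ₃ τ₃)
    (h : Exch (word ρ z) (σ₁ z) (σ₂ z) (σ₃ z) (τ₁ z) (τ₂ z) (τ₃ z)) (hk : z < k) :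
    ρ₃ k = μ₃ k := by
  have hρ₁ := h₁.good hρ hx
  have hρ₂ := h₂.good hρ₁ hy
  have hμ₁ := k₁.good hρ ha'
  have step : ∀ k, z ≤ k → Exch (word ρ k) (σ₁ k) (σ₂ k) (σ₃ k) (τ₁ k) (τ₂ k) (τ₃ k) →
      ρ₃ (k + 1) = μ₃ (k + 1) ∧ Exch (word ρ (k + 1)) (σ₁ (k + 1)) (σ₂ (k + 1)) (σ₃ (k + 1))
        (τ₁ (k + 1)) (τ₂ (k + 1)) (τ₃ (k + 1)) := by
    intro k hk hE
    have p₁ := h₁.above (k + 1) (by omega)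
    have p₂ := h₂.above (k + 1) (by omega)
    have p₃ := h₃.above (k + 1) (by omega)
    have q₁ := k₁.above (k + 1) (by omega)
    have q₂ := k₂.above (k + 1) (by omega)
    have q₃ := k₃.above (k + 1) (by omega)
    have hok := hρ (k + 1) (by omega)
    rw [add_sub_cancel_right] at p₁ p₂ p₃ q₁ q₂ q₃ hok
    rw [h₁.word_eq hρ hx (by omega)] at p₂
    rw [h₂.word_eq hρ₁ hy (by omega), h₁.word_eq hρ hx (by omega)] at p₃
    rw [k₁.word_eq hρ ha' (by omega)] at q₂
    rw [k₂.word_eq hμ₁ hb' (by omega), k₁.word_eq hρ ha' (by omega)] at q₃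
    rw [word_of_pos ρ (by omega : 0 < k + 1), add_sub_cancel_right]
    exact RowPass.exch hE hok p₁ p₂ p₃ q₁ q₂ q₃
  have all : ∀ k, z ≤ k → Exch (word ρ k) (σ₁ k) (σ₂ k) (σ₃ k) (τ₁ k) (τ₂ k) (τ₃ k) := by
    intro k hk
    induction k, hk using Int.leInduction with
    | base => exact h
    | succ k hk ih => exact (step k hk ih).2
  have := (step (k - 1) (by omega) (all _ (by omega))).1
  rwa [sub_add_cancel] at this

/-- `R ← yxz = R ← yzx` for `x < y ≤ z`, in terms of rows. -/
theorem InsRows.knuth_right (hρ : Good ρ) (hx : 0 < x) (hxy : x < y) (hyz : y ≤ z)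
    (h₁ : InsRows ρ y ρ₁ σ₁) (h₂ : InsRows ρ₁ x ρ₂ σ₂) (h₃ : InsRows ρ₂ z ρ₃ σ₃)
    (k₂ : InsRows ρ₁ z μ₂ τ₂) (k₃ : InsRows μ₂ x μ₃ τ₃) : ρ₃ = μ₃ := by
  have hy : 0 < y := by omega
  have hz : 0 < z := by omega
  have hρ₁ := h₁.good hρ hy
  have hρ₂ := h₂.good hρ₁ hx
  obtain ⟨hlow, hlow'⟩ := h₂.eq_of_agree k₃ (k := z - 1) (fun i hi => k₂.below i (by omega))
  -- The hop of x stays left of the hop of y. In row y the added crossing sits at the last positive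
  -- place: a hop starting there is bumped to the left, and one ending just beyond it has its target
  -- moved back onto it.
  have hdesc : ∀ k, y ≤ k → (σ₂ k).2 ≤ (σ₁ k).1 := by
    intro k hk
    induction k, hk using Int.leInduction with
    | base =>
      have p := h₂.above y hxy
      rw [h₁.row, rowPass_append] at p
      obtain ⟨l₁, l₂, B, -, p₁, p₂⟩ := p
      obtain ⟨r, -, p₂⟩ := rowPass_singleton.1 p₂
      have hB := p₁.hop (h₂.hop hρ₁ hx (by omega)) (by
        rw [h₁.word_below (by omega)]; exact hρ y hy)
      rw [h₁.word_below (by omega), ← word_of_pos ρ hy] at p₂ hB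
      have hL := h₁.last
      have b1 := hB.pos
      have b2 := hB.nonpos
      have b3 := hB.between
      have b4 := hB.lt
      have l1 := hL.1
      have l2 := hL.2 B.1
      have l3 := hL.2 ((σ₁ y).1 + 1)
      rcases p₂ with ⟨h, rfl, e⟩ | ⟨h, hM, e⟩
      · have b5 := b3 ((σ₁ y).1 + 1)
        rw [e]
        grind [sw]
      · have := hM.lt
        rw [e]
        simp only
        omega
    | succ k hk ih =>
      have p := h₁.above (k + 1) (by omega)
      have q := h₂.above (k + 1) (by omega)
      rw [add_sub_cancel_right] at p q
      have hB := h₂.hop hρ₁ hx (k := k) (by omega)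
      rw [h₁.word_eq hρ hy (by omega)] at q hB
      have hok := hρ (k + 1) (by omega)
      rw [add_sub_cancel_right] at hok
      exact RowPass.le_of_le hok (h₁.hop hρ hy (by omega)) hB ih p q
  have hA := h₁.hop hρ hy hyz
  have hB := h₂.hop hρ₁ hx (k := z) (by omega)
  have hu := h₁.word_eq hρ hy hyz
  have hd := hdesc z hyz
  have hi : (σ₁ z).1 < (τ₂ z).1 := hA.lt_of_isLast (hu ▸ k₂.last)
  -- The hop of x lies left of the last positive place and leaves it where it is.
  have hj : (σ₃ z).1 = (τ₂ z).1 := by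
    refine h₃.last.unique ⟨?_, ?_⟩
    · have := k₂.last.1
      rw [h₂.word_eq hρ₁ hx (by omega)]
      have := hB.lt
      grind [swp]
    · intro i hi'
      have := k₂.last.2 i hi'
      have := hB.lt
      rw [h₂.word_eq hρ₁ hx (by omega)]
      grind [swp]
  have ez : ρ₃ z = μ₃ z ∧ τ₃ z = σ₂ z := by
    have p := k₃.above z (by omega)
    rw [k₂.row, rowPass_append, k₂.word_below (by omega), ← word_of_pos ρ₁ hz] at p
    obtain ⟨l₁, l₂, B, e, p₁, p⟩ := p
    obtain ⟨r, rfl, p₂⟩ := rowPass_singleton.1 p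
    rw [hlow' _ (by omega) (by omega)] at p₁
    obtain ⟨rfl, rfl⟩ := p₁.unique (h₂.above z (by omega))
    have b1 := hB.lt
    rcases p₂ with ⟨-, rfl, e'⟩ | ⟨h, -, -⟩
    · refine ⟨?_, ?_⟩
      · rw [e, h₃.row, hj]
      · rw [e']
        ext <;> grind [sw]
    · omega
  have hE : Exch (word ρ z) (σ₁ z) (τ₂ z) (τ₃ z) (σ₁ z) (σ₂ z) (σ₃ z) := by
    have : σ₃ z = τ₂ z := by rw [h₃.fst, k₂.fst, hj]
    rw [this, ez.2]
    refine .right hA (hu ▸ hB) ?_ hd hi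
    rw [← hu]
    exact k₂.hop hρ₁ hz le_rfl
  funext k
  rcases lt_trichotomy k z with hk | rfl | hk
  · rw [h₃.below k hk, hlow k (by omega)]
  · exact ez.1
  · exact (InsRows.rows_eq_of_exch hρ hy hz hy hx hyz le_rfl (by omega) hyz (by omega)
      le_rfl h₁ k₂ k₃ h₁ h₂ h₃ hE hk).symm

/-- `R ← xzy = R ← zxy` for `x ≤ y < z`, in terms of rows. -/
theorem InsRows.knuth_left (hρ : Good ρ) (hx : 0 < x) (hxy : x ≤ y) (hyz : y < z)
    (h₁ : InsRows ρ x ρ₁ σ₁) (h₂ : InsRows ρ₁ z ρ₂ σ₂) (h₃ : InsRows ρ₂ y ρ₃ σ₃)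
    (k₁ : InsRows ρ z μ₁ τ₁) (k₂ : InsRows μ₁ x μ₂ τ₂) (k₃ : InsRows μ₂ y μ₃ τ₃) : ρ₃ = μ₃ := by
  have hy : 0 < y := by omega
  have hz : 0 < z := by omega
  have hρ₁ := h₁.good hρ hx
  have hρ₂ := h₂.good hρ₁ hz
  have hμ₁ := k₁.good hρ hz
  obtain ⟨hlow, hlow'⟩ := h₁.eq_of_agree k₂ (k := z - 1) (fun i hi => k₁.below i (by omega))
  have hlow₂ : ∀ i, i ≤ z - 1 → μ₂ i = ρ₂ i := fun i hi => by
    rw [hlow i hi, h₂.below i (by omega)]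
  obtain ⟨hlow₃, hlow₃'⟩ := h₃.eq_of_agree k₃ hlow₂
  -- The hop of y starts right of the hop of x. This is followed only below row z, which receives an
  -- extra crossing.
  have hasc : ∀ k, y ≤ k → k ≤ z - 1 → (σ₁ k).1 < (σ₃ k).1 := by
    intro k hk
    induction k, hk using Int.leInduction with
    | base =>
      intro hk
      refine (h₁.hop hρ hx hxy).lt_of_isLast ?_
      rw [← h₁.word_eq hρ hx hxy, ← h₂.word_below hyz]
      exact h₃.last
    | succ k hk ih =>
      intro hk'
      have p := h₁.above (k + 1) (by omega)
      have q := h₃.above (k + 1) (by omega)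
      rw [add_sub_cancel_right] at p q
      have hB := h₃.hop hρ₂ hy (k := k) (by omega)
      rw [h₂.word_below (by omega), h₁.word_eq hρ hx (by omega)] at q hB
      rw [h₂.below _ (by omega)] at q
      have hok := hρ (k + 1) (by omega)
      rw [add_sub_cancel_right] at hok
      exact RowPass.lt_of_lt hok (h₁.hop hρ hx (by omega)) hB (ih (by omega)) p q
  have hA := h₁.hop hρ hx (k := z) (by omega)
  have hu := h₁.word_eq hρ hx (k := z) (by omega)
  have pA := h₁.above z (by omega)
  have pC := h₃.above z (by omega)
  rw [h₂.row, rowPass_append, h₂.word_below (by omega), ← word_of_pos ρ₁ hz] at pC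
  obtain ⟨l, l', C, eC, pC, hpC'⟩ := pC
  obtain ⟨r₃, rfl, pC'⟩ := rowPass_singleton.1 hpC'
  have qA := k₂.above z (by omega)
  rw [k₁.row, rowPass_append, k₁.word_below (by omega), ← word_of_pos ρ hz,
    hlow' _ (by omega) (by omega)] at qA
  obtain ⟨m, m', A', eA, qA, hqA'⟩ := qA
  obtain ⟨r₂, rfl, qA'⟩ := rowPass_singleton.1 hqA'
  obtain ⟨rfl, rfl⟩ := qA.unique pA
  have hw₂ : word μ₂ (z - 1) = word ρ₁ (z - 1) := word_congr fun i _ hi => hlow i hi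
  have qC := k₃.above z (by omega)
  rw [eA, rowPass_append, hw₂, ← word_of_pos ρ₁ hz, hlow₃' _ (by omega) (by omega)] at qC
  obtain ⟨m, m', C', eC', qC, hqC'⟩ := qC
  obtain ⟨q₃, rfl, qC'⟩ := rowPass_singleton.1 hqC'
  obtain ⟨rfl, rfl⟩ := qC.unique pC
  have hCz : Hop (word ρ₁ (z - 1)) (σ₃ (z - 1)) := by
    rw [← h₂.word_below (by omega)]
    exact h₃.hop hρ₂ hy (by omega)
  have hC : Hop (word ρ₁ z) C' := by
    rw [word_of_pos ρ₁ hz]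
    exact pC.hop hCz (hρ₁ z hz)
  have hAC : (σ₁ z).1 < C'.1 := by
    rw [h₁.word_eq hρ hx (by omega)] at pC hCz
    exact RowPass.lt_of_lt (hρ z hz) (h₁.hop hρ hx (by omega)) hCz (hasc _ (by omega) (by omega))
      pA pC
  have l₁ := h₂.last
  rw [hu] at hC l₁ pC' qC'
  have l₂ := k₁.last
  -- Any place to the right of both hops and of both last positive entries will do: there a last
  -- positive entry of the whole word is a `LastPos`, as `Exch.of_last` requires.
  obtain ⟨r, hr₁, hr₂, hr₃, hr₄⟩ : ∃ r, (σ₁ z).2 < r ∧ C'.2 ≤ r ∧ (σ₂ z).1 < r ∧ (τ₁ z).1 < r :=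
    ⟨max (max ((σ₁ z).2 + 1) C'.2) (max ((σ₂ z).1 + 1) ((τ₁ z).1 + 1)), by omega, by omega,
      by omega, by omega⟩
  obtain ⟨rfl, hE⟩ := Exch.of_last hA hr₁ (l₂.2 _ hr₄) hC hAC hr₂ (l₁.lastPos hr₃)
    (l₂.lastPos hr₄) pC' qA' qC'
  rw [← h₂.fst, ← k₁.fst] at hE
  funext k
  rcases lt_trichotomy k z with hk | rfl | hk
  · rw [hlow₃ k (by omega)]
  · rw [eC, eC']
  · exact InsRows.rows_eq_of_exch hρ hx hz hz hx (by omega) le_rfl (by omega) le_rfl (by omega)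
      (by omega) h₁ h₂ h₃ k₁ k₂ k₃ hE hk

end

/-! ### Every place is entered by a strand from either side -/

theorem Enters.le_row {n a : ℤ} {R : Finset (ℤ × ℤ)} {s : Side} {p : ℤ × ℤ}
    (h : Enters n R a s p) : a ≤ p.2 := by
  induction h <;> simp only at * <;> omega

/-- All rows up to `K` are empty, and there strands climb staircases: the strand left of a place
was, one column earlier, left of the place one row below. From there one proceeds row by row, and
from left to right within a row. -/
theorem Enters.exists {n K : ℤ} {R : Finset (ℤ × ℤ)} (hK : ∀ p ∈ R, K < p.2) :
    ∀ (m : ℕ) (i k : ℤ), i ≤ n → k ≤ n → k - K ≤ m →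
      (∃ a, Enters n R a .left (i, k)) ∧ ∃ b, Enters n R b .bottom (i, k) := by
  have low : ∀ (c : ℕ) (k : ℤ), k ≤ K + 1 → k ≤ n → (k ≤ K → ∃ a, Enters n R a .left (n - c, k)) ∧
      ∃ b, Enters n R b .bottom (n - c, k) := by
    intro c
    have up : ∀ k : ℤ, k ≤ K + 1 → k ≤ n → (∃ a, Enters n R a .left (n - c, k - 1)) →
        ∃ b, Enters n R b .bottom (n - c, k) := by
      rintro k hk hn ⟨a, ha⟩
      refine ⟨a, ?_⟩
      have := ha.turn_up (fun h => by have := hK _ h; simp only at this; omega) (by omega)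
      rwa [sub_add_cancel] at this
    induction c with
    | zero =>
      intro k hk hn
      refine ⟨fun _ => ⟨k, by simpa using Enters.start hn⟩, up k hk hn ⟨k - 1, ?_⟩⟩
      simpa using Enters.start (n := n) (R := R) (a := k - 1) (by omega)
    | succ c ih =>
      have left : ∀ k : ℤ, k ≤ K → k ≤ n → ∃ a, Enters n R a .left (n - (c + 1 : ℕ), k) := by
        intro k hk hn
        obtain ⟨-, b, hb⟩ := ih (fun k hk hn h => by
          obtain ⟨a, ha⟩ := h
          exact ⟨a, by
            have := ha.turn_up (fun h => by have := hK _ h; simp only at this; omega) (by omega)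
            rwa [sub_add_cancel] at this⟩) k (by omega) hn
        refine ⟨b, ?_⟩
        have := hb.turn_right (fun h => by have := hK _ h; simp only at this; omega)
        rwa [show n - (c : ℤ) - 1 = n - (c + 1 : ℕ) by push_cast; ring] at this
      intro k hk hn
      exact ⟨fun h => left k h hn, up k hk hn (left (k - 1) (by omega) (by omega))⟩
  intro m
  induction m with
  | zero =>
    intro i k hi hk hm
    have := low (n - i).toNat k (by omega) hk
    rw [show n - ((n - i).toNat : ℤ) = i by omega] at this
    exact ⟨this.1 (by omega), this.2⟩
  | succ m ih =>
    have bottom : ∀ i k : ℤ, i ≤ n → k ≤ n → k - K ≤ m + 1 →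
        ∃ b, Enters n R b .bottom (i, k) := by
      intro i k hi hk hm
      obtain ⟨⟨a, ha⟩, b, hb⟩ := ih i (k - 1) hi (by omega) (by omega)
      by_cases h : (i, k - 1) ∈ R
      · have := hb.cross_up h (by omega)
        rw [sub_add_cancel] at this
        exact ⟨b, this⟩
      · have := ha.turn_up h (by omega)
        rw [sub_add_cancel] at this
        exact ⟨a, this⟩
    have left : ∀ (c : ℕ) (k : ℤ), k ≤ n → k - K ≤ m + 1 →
        ∃ b, Enters n R b .left (n - c, k) := by
      intro c
      induction c with
      | zero => intro k hk _; exact ⟨k, by simpa using Enters.start hk⟩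
      | succ c ihc =>
        intro k hk hm
        obtain ⟨a, ha⟩ := ihc k hk hm
        obtain ⟨b, hb⟩ := bottom (n - c) k (by omega) hk hm
        rw [show n - ((c + 1 : ℕ) : ℤ) = n - c - 1 by push_cast; ring]
        by_cases h : (n - (c : ℤ), k) ∈ R
        · exact ⟨a, ha.cross_right h⟩
        · exact ⟨b, hb.turn_right h⟩
    intro i k hi hk hm
    refine ⟨?_, bottom i k hi hk (by push_cast at hm; omega)⟩
    have := left (n - i).toNat k hk (by push_cast at hm; omega)
    rwa [show n - ((n - i).toNat : ℤ) = i by omega] at this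

theorem Enters.exists_of_finset {n : ℤ} (R : Finset (ℤ × ℤ)) {i k : ℤ} (hi : i ≤ n) (hk : k ≤ n) :
    (∃ a, Enters n R a .left (i, k)) ∧ ∃ b, Enters n R b .bottom (i, k) := by
  obtain ⟨K, hK⟩ : ∃ K : ℤ, ∀ p ∈ R, K < p.2 := by
    obtain ⟨K, hK⟩ := (R.image Prod.snd).bddBelow
    refine ⟨K - 1, fun p hp => ?_⟩
    have := hK (Finset.mem_coe.2 (Finset.mem_image_of_mem Prod.snd hp))
    omega
  exact Enters.exists hK (k - K).toNat i k hi hk (by omega)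

/-! ### Reading a table as rows, and strands as entries of words -/

/-- `ρ k` lists the crossings of `R` in the row `k`, the place `(i, k)` being given by `n - i - k`. -/
structure Rows (n : ℤ) (R : Finset (ℤ × ℤ)) (ρ : ℤ → List ℤ) : Prop where
  mem : ∀ i k : ℤ, (i, k) ∈ R ↔ n - i - k ∈ ρ k
  sorted : ∀ k, ((-k - 1) :: ρ k).Pairwise (· < ·)
  nonpos : ∀ k, k ≤ 0 → ρ k = []
  top : ∀ k, n < k → ρ k = []

theorem Rows.eq {n : ℤ} {R S : Finset (ℤ × ℤ)} {ρ : ℤ → List ℤ} (h : Rows n R ρ) (h' : Rows n S ρ) :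
    R = S := by
  ext ⟨i, k⟩
  rw [h.mem, h'.mem]

/-- The word just before the place `q` of the row `k`. -/
def stage (ρ : ℤ → List ℤ) (k q : ℤ) : ℤ → ℤ :=
  run (word ρ (k - 1)) ((ρ k).filter (· < q))

/-- The label of the strand entering a place through a side. -/
def label (n : ℤ) (ρ : ℤ → List ℤ) : Side → ℤ × ℤ → ℤ
  | .left, p => stage ρ p.2 (n - p.1 - p.2) (n - p.1 - p.2)
  | .bottom, p => stage ρ p.2 (n - p.1 - p.2) (n - p.1 - p.2 + 1)

theorem run_of_lt {l : List ℤ} {q : ℤ} : ∀ {v : ℤ → ℤ}, (∀ r ∈ l, r + 1 < q) → run v l q = v q := by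
  induction l with
  | nil => intro v _; rfl
  | cons r l ih =>
    intro v h
    rw [run_cons, ih fun x hx => h x (by simp [hx])]
    have := h r (by simp)
    grind [swp]

theorem run_of_gt {l : List ℤ} {q : ℤ} : ∀ {v : ℤ → ℤ}, (∀ r ∈ l, q < r) → run v l q = v q := by
  induction l with
  | nil => intro v _; rfl
  | cons r l ih =>
    intro v h
    rw [run_cons, ih fun x hx => h x (by simp [hx])]
    have := h r (by simp)
    grind [swp]

theorem filter_append_filter {l : List ℤ} (h : l.Pairwise (· < ·)) (q : ℤ) :
    l.filter (· < q) ++ l.filter (q ≤ ·) = l := by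
  induction l with
  | nil => rfl
  | cons r l ih =>
    have h' := List.pairwise_cons.1 h
    by_cases hr : r < q
    · simp only [List.filter_cons, hr, decide_true, if_true, not_le.2 hr, decide_false,
        Bool.false_eq_true, if_false, List.cons_append, ih h'.2]
    · have e : l.filter (· < q) = [] := by
        rw [List.filter_eq_nil_iff]
        intro x hx
        have := h'.1 x hx
        simp; omega
      have e' : l.filter (q ≤ ·) = l := by
        rw [List.filter_eq_self]
        intro x hx
        have := h'.1 x hx
        simp; omega
      simp [hr, not_lt.1 hr, e, e']

theorem filter_of_eq_append {l l₁ l₂ : List ℤ} {q : ℤ} (h : l.Pairwise (· < ·))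
    (e : l = l₁ ++ q :: l₂) : l.filter (· < q) = l₁ := by
  subst e
  have h' := List.pairwise_append.1 h
  have h1 : l₁.filter (· < q) = l₁ := by
    rw [List.filter_eq_self]
    intro x hx
    simpa using h'.2.2 x hx q (by simp)
  have h2 : l₂.filter (· < q) = [] := by
    rw [List.filter_eq_nil_iff]
    intro x hx
    have := (List.pairwise_cons.1 h'.2.1).1 x hx
    simp; omega
  simp [h1, h2]

theorem eq_filter_append {l : List ℤ} {q : ℤ} (h : l.Pairwise (· < ·)) (hq : q ∈ l) :
    ∃ l₂, l = l.filter (· < q) ++ q :: l₂ := by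
  obtain ⟨l₁, l₂, e⟩ := List.append_of_mem hq
  exact ⟨l₂, by rw [filter_of_eq_append h e]; exact e⟩

theorem filter_lt_succ {l : List ℤ} {q : ℤ} (h : l.Pairwise (· < ·)) (hq : q ∈ l) :
    l.filter (· < q + 1) = l.filter (· < q) ++ [q] := by
  obtain ⟨l₂, e⟩ := eq_filter_append h hq
  have h' : l.Pairwise (· < ·) := h
  rw [e, List.pairwise_append] at h'
  have h2 : l₂.filter (· < q + 1) = [] := by
    rw [List.filter_eq_nil_iff]
    intro x hx
    have := (List.pairwise_cons.1 h'.2.1).1 x hx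
    simp; omega
  have h1 : (l.filter (· < q)).filter (· < q + 1) = l.filter (· < q) := by
    rw [List.filter_eq_self]
    intro x hx
    have := (List.mem_filter.1 hx).2
    simp at this ⊢; omega
  conv_lhs => rw [e]
  rw [List.filter_append, h1, List.filter_cons, h2]
  simp

theorem filter_lt_succ_of_notMem {l : List ℤ} {q : ℤ} (hq : q ∉ l) :
    l.filter (· < q + 1) = l.filter (· < q) := by
  apply List.filter_congr
  intro x hx
  have : x ≠ q := fun e => hq (e ▸ hx)
  rw [decide_eq_decide]
  omega

section
variable {n : ℤ} {R : Finset (ℤ × ℤ)} {ρ : ℤ → List ℤ} {k q : ℤ}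

theorem Rows.row_sorted (h : Rows n R ρ) (k : ℤ) : (ρ k).Pairwise (· < ·) :=
  (List.pairwise_cons.1 (h.sorted k)).2

theorem Rows.le_of_mem (h : Rows n R ρ) (hq : q ∈ ρ k) : -k ≤ q := by
  have := (List.pairwise_cons.1 (h.sorted k)).1 q hq
  omega

theorem Rows.pos_of_mem (h : Rows n R ρ) (hq : q ∈ ρ k) : 0 < k := by
  by_contra hk
  rw [h.nonpos k (by omega)] at hq
  simp at hq

theorem Rows.le_top_of_mem (h : Rows n R ρ) (hq : q ∈ ρ k) : k ≤ n := by
  by_contra hk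
  rw [h.top k (by omega)] at hq
  simp at hq

theorem Rows.word_eq (h : Rows n R ρ) (k : ℤ) : word ρ k = run (word ρ (k - 1)) (ρ k) := by
  rcases le_or_gt k 0 with hk | hk
  · rw [h.nonpos k hk, word_of_nonpos _ hk, word_of_nonpos _ (by omega)]; rfl
  · exact word_of_pos ρ hk

theorem Rows.stage_succ (h : Rows n R ρ) (hq : q ∈ ρ k) :
    stage ρ k (q + 1) = swp q (q + 1) (stage ρ k q) := by
  rw [stage, filter_lt_succ (h.row_sorted k) hq, run_append]; rfl

theorem stage_succ_of_notMem (hq : q ∉ ρ k) : stage ρ k (q + 1) = stage ρ k q := by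
  rw [stage, filter_lt_succ_of_notMem hq]; rfl

theorem Rows.word_eq_run_stage (h : Rows n R ρ) (k q : ℤ) :
    word ρ k = run (stage ρ k q) ((ρ k).filter (q ≤ ·)) := by
  rw [stage, ← run_append, filter_append_filter (h.row_sorted k), h.word_eq]

/-- The remaining crossings of the row lie beyond q, so the entry at q is final. It is the strand
leaving upwards. -/
theorem Rows.word_apply (h : Rows n R ρ) (k q : ℤ) : word ρ k q = stage ρ k (q + 1) q := by
  rw [h.word_eq_run_stage k (q + 1), run_of_gt]
  intro r hr
  have := (List.mem_filter.1 hr).2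
  simp at this; omega

theorem stage_apply (k q : ℤ) : stage ρ k q (q + 1) = word ρ (k - 1) (q + 1) := by
  rw [stage, run_of_lt]
  intro r hr
  have := (List.mem_filter.1 hr).2
  simp at this; omega

theorem Rows.word_unborn (h : Rows n R ρ) (hq : q < -k) : word ρ k q = -q := by
  rcases le_or_gt k 0 with hk | hk
  · rw [word_of_nonpos _ hk]
  · obtain ⟨m, rfl⟩ : ∃ m : ℕ, k = m := ⟨k.toNat, by omega⟩
    clear hk
    induction m with
    | zero => rw [word_of_nonpos _ (by simp)]
    | succ m ih =>
      push_cast at hq ⊢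
      rw [h.word_eq, add_sub_cancel_right, run_of_gt, ih (by omega)]
      intro r hr
      have := h.le_of_mem hr
      omega

theorem Rows.stage_start (h : Rows n R ρ) (k : ℤ) : stage ρ k (-k) = word ρ (k - 1) := by
  have : (ρ k).filter (· < -k) = [] := by
    rw [List.filter_eq_nil_iff]
    intro r hr
    have := h.le_of_mem hr
    simp; omega
  rw [stage, this]; rfl

/-- A step to the right raises the coordinate by one. A step up lowers it by one, so the strand
leaving the place q upwards stands at (q - 1) + 1 in the next row, the bottom side of q - 1. -/
theorem Rows.label_of_enters (h : Rows n R ρ) {a : ℤ} {s : Side} {p : ℤ × ℤ}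
    (he : Enters n R a s p) : a = label n ρ s p := by
  induction he with
  | start ha =>
    simp only [label]
    rw [show n - n - a = -a by ring, h.stage_start, h.word_unborn (by omega)]
    ring
  | @cross_right i k _ hm ih =>
    simp only [label] at *
    rw [h.mem] at hm
    rw [ih, show n - (i - 1) - k = n - i - k + 1 by ring, h.stage_succ hm]
    simp [swp]
  | @cross_up i k _ hm _ ih =>
    simp only [label] at *
    rw [h.mem] at hm
    rw [ih, stage_apply (k + 1), add_sub_cancel_right, show n - i - (k + 1) + 1 = n - i - k by ring,
      h.word_apply, h.stage_succ hm]
    simp [swp]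
  | @turn_up i k _ hm _ ih =>
    simp only [label] at *
    rw [h.mem] at hm
    rw [ih, stage_apply (k + 1), add_sub_cancel_right, show n - i - (k + 1) + 1 = n - i - k by ring,
      h.word_apply, stage_succ_of_notMem hm]
  | @turn_right i k _ hm ih =>
    simp only [label] at *
    rw [h.mem] at hm
    rw [ih, show n - (i - 1) - k = n - i - k + 1 by ring, stage_succ_of_notMem hm]

theorem Rows.enters_iff (h : Rows n R ρ) {a : ℤ} {s : Side} {i k : ℤ} (hi : i ≤ n) (hk : k ≤ n) :
    Enters n R a s (i, k) ↔ a = label n ρ s (i, k) := by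
  refine ⟨h.label_of_enters, ?_⟩
  rintro rfl
  obtain ⟨⟨b, hb⟩, c, hc⟩ := Enters.exists_of_finset R hi hk
  cases s
  · rwa [← h.label_of_enters hb]
  · rwa [← h.label_of_enters hc]

/-- In the row `k`, the strands `a` and `b` intersect at `q`. -/
def Meet (ρ : ℤ → List ℤ) (a b k q : ℤ) : Prop :=
  q ∈ ρ k ∧ ((a = stage ρ k q q ∧ b = stage ρ k q (q + 1)) ∨
    (b = stage ρ k q q ∧ a = stage ρ k q (q + 1)))

theorem Rows.intersectAt_iff (h : Rows n R ρ) {a b i k : ℤ} :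
    IntersectAt n R a b (i, k) ↔ Meet ρ a b k (n - i - k) := by
  unfold IntersectAt Meet
  rw [h.mem]
  refine and_congr_right fun hm => ?_
  have h1 := h.le_of_mem hm
  have h2 := h.le_top_of_mem hm
  rw [h.enters_iff (by omega) h2, h.enters_iff (by omega) h2, h.enters_iff (by omega) h2,
    h.enters_iff (by omega) h2]
  rfl

theorem Rows.isOpenSpace_iff (h : Rows n R ρ) {i k : ℤ} :
    IsOpenSpace n R (i, k) ↔ i ≤ n ∧ k ≤ n ∧ n - i - k ∉ ρ k ∧
      0 < stage ρ k (n - i - k) (n - i - k) ∧ stage ρ k (n - i - k) (n - i - k + 1) ≤ 0 := by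
  unfold IsOpenSpace
  refine and_congr_right fun hi => and_congr_right fun hk => ?_
  rw [h.mem]
  refine and_congr_right fun _ => ?_
  simp only [h.enters_iff hi hk, label]
  constructor
  · rintro ⟨a, b, hb, ha, rfl, rfl⟩
    exact ⟨ha, hb⟩
  · rintro ⟨ha, hb⟩
    exact ⟨_, _, hb, ha, rfl, rfl⟩

end

/-! ### RC-graphs and rows whose crossings are all descents -/

theorem swp_injective {v : ℤ → ℤ} (h : Function.Injective v) (s t : ℤ) :
    Function.Injective (swp s t v) := by
  intro i j hij
  have := @h
  unfold Function.Injective at this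
  grind [swp]

theorem run_injective {l : List ℤ} : ∀ {v : ℤ → ℤ}, Function.Injective v →
    Function.Injective (run v l) := by
  induction l with
  | nil => intro v h; exact h
  | cons r l ih => intro v h; exact ih (swp_injective h _ _)

theorem word_injective (ρ : ℤ → List ℤ) (k : ℤ) : Function.Injective (word ρ k) := by
  unfold word
  induction k.toNat with
  | zero => exact neg_injective
  | succ m ih => exact run_injective ih

theorem stage_injective (ρ : ℤ → List ℤ) (k q : ℤ) : Function.Injective (stage ρ k q) :=
  run_injective (word_injective _ _)

section
variable {n : ℤ} {R : Finset (ℤ × ℤ)} {ρ : ℤ → List ℤ} {a b k k' q q' m : ℤ}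

theorem Rows.crossing (h : Rows n R ρ) (hok : RowOK (word ρ (k - 1)) (ρ k)) (hq : q ∈ ρ k) :
    Crossing (stage ρ k q) q := by
  obtain ⟨l, e⟩ := eq_filter_append (h.row_sorted k) hq
  rw [e, rowOK_append] at hok
  exact hok.2.1

theorem Rows.word_eq_run (h : Rows n R ρ) (k q : ℤ) : ∃ l, word ρ k = run (stage ρ k q) l ∧
    (RowOK (word ρ (k - 1)) (ρ k) → RowOK (stage ρ k q) l) := by
  refine ⟨_, h.word_eq_run_stage k q, fun hok => ?_⟩
  rw [← filter_append_filter (h.row_sorted k) q, rowOK_append] at hok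
  exact hok.2

theorem Rows.stage_eq_run (h : Rows n R ρ) (k : ℤ) (hq : q ≤ q') :
    ∃ l, stage ρ k q' = run (stage ρ k q) l ∧
      (RowOK (word ρ (k - 1)) (ρ k) → RowOK (stage ρ k q) l) := by
  have hs : ((ρ k).filter (· < q')).Pairwise (· < ·) := (h.row_sorted k).filter _
  have e := filter_append_filter hs q
  have e' : ((ρ k).filter (· < q')).filter (· < q) = (ρ k).filter (· < q) := by
    rw [List.filter_filter]
    apply List.filter_congr
    intro x _
    rw [← Bool.decide_and, decide_eq_decide]
    omega
  rw [e'] at e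
  refine ⟨((ρ k).filter (· < q')).filter (q ≤ ·), ?_, fun hok => ?_⟩
  · rw [stage, stage, ← run_append, e]
  · rw [← filter_append_filter (h.row_sorted k) q', rowOK_append] at hok
    have := hok.1
    rw [← e, rowOK_append] at this
    exact this.2

/-- The strand `b` precedes the strand `a` in the word `v`. -/
def Before (v : ℤ → ℤ) (b a : ℤ) : Prop := ∃ x y, x < y ∧ v x = b ∧ v y = a

theorem Before.run {l : List ℤ} (hab : b < a) : ∀ {v : ℤ → ℤ}, RowOK v l → Before v b a →
    Before (run v l) b a := by
  induction l with
  | nil => intro v _ h; exact h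
  | cons r l ih =>
    rintro v hok ⟨x, y, hxy, hx, hy⟩
    refine ih hok.2 ⟨sw r x, sw r y, ?_, (swp_sw v r x).trans hx, (swp_sw v r y).trans hy⟩
    have := hok.1.gt
    grind [sw]

theorem Rows.before_of_cross (h : Rows n R ρ) (hok : ∀ k, 0 < k → k ≤ m → RowOK (word ρ (k - 1)) (ρ k))
    (hq : q ∈ ρ k) (hk' : k' ≤ m) (hlt : k < k' ∨ k = k' ∧ q < q') :
    Before (stage ρ k' q') (stage ρ k q (q + 1)) (stage ρ k q q) := by
  have hk := h.pos_of_mem hq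
  have hc := h.crossing (hok k hk (by omega)) hq
  have h0 : Before (stage ρ k (q + 1)) (stage ρ k q (q + 1)) (stage ρ k q q) := by
    refine ⟨q, q + 1, by omega, ?_, ?_⟩ <;> rw [h.stage_succ hq] <;> simp [swp]
  rcases hlt with hlt | ⟨rfl, hlt⟩
  · have h1 : ∀ j, k ≤ j → j ≤ m → Before (word ρ j) (stage ρ k q (q + 1)) (stage ρ k q q) := by
      intro j hj
      induction j, hj using Int.leInduction with
      | base =>
        intro hm
        obtain ⟨l, e, hl⟩ := h.word_eq_run k (q + 1)
        rw [e]
        exact h0.run hc.gt (hl (hok k hk hm))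
      | succ j hj ih =>
        intro hm
        rw [h.word_eq, add_sub_cancel_right]
        have := hok (j + 1) (by omega) hm
        rw [add_sub_cancel_right] at this
        exact (ih (by omega)).run hc.gt this
    have h2 := h1 (k' - 1) (by omega) (by omega)
    have h3 := hok k' (by omega) hk'
    rw [← filter_append_filter (h.row_sorted k') q', rowOK_append] at h3
    exact h2.run hc.gt h3.1
  · obtain ⟨l, e, hl⟩ := h.stage_eq_run k (show q + 1 ≤ q' by omega)
    rw [e]
    exact h0.run hc.gt (hl (hok k hk hk'))

/-- Where two strands cross, the larger one stands on the left. Afterwards it stands on the right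
for good, since no crossing exchanges an ascending pair. -/
theorem Rows.not_meet_later (h : Rows n R ρ)
    (hok : ∀ k, 0 < k → k ≤ m → RowOK (word ρ (k - 1)) (ρ k)) (h₁ : Meet ρ a b k q)
    (h₂ : Meet ρ a b k' q') (hk' : k' ≤ m) : ¬ (k < k' ∨ k = k' ∧ q < q') := by
  intro hlt
  obtain ⟨x, y, hxy, hx, hy⟩ := h.before_of_cross hok h₁.1 hk' hlt
  have hc := h.crossing (hok k (h.pos_of_mem h₁.1) (by omega)) h₁.1
  have hc' := h.crossing (hok k' (h.pos_of_mem h₂.1) hk') h₂.1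
  have hgt := hc.gt
  have hgt' := hc'.gt
  have hinj := stage_injective ρ k' q'
  have key : stage ρ k' q' x = stage ρ k' q' (q' + 1) ∧ stage ρ k' q' y = stage ρ k' q' q' := by
    rw [hx, hy]
    rcases h₁.2 with ⟨e1, e2⟩ | ⟨e1, e2⟩ <;> rcases h₂.2 with ⟨e3, e4⟩ | ⟨e3, e4⟩ <;> omega
  have := hinj key.1
  have := hinj key.2
  omega

theorem Rows.meet_unique (h : Rows n R ρ)
    (hok : ∀ k, 0 < k → k ≤ m → RowOK (word ρ (k - 1)) (ρ k)) (h₁ : Meet ρ a b k q)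
    (h₂ : Meet ρ a b k' q') (hk : k ≤ m) (hk' : k' ≤ m) : k = k' ∧ q = q' := by
  have := h.not_meet_later hok h₁ h₂ hk'
  have := h.not_meet_later hok h₂ h₁ hk
  omega

theorem Rows.isRCGraph (h : Rows n R ρ) (hρ : Good ρ) : IsRCGraph n R := by
  refine ⟨?_, ?_⟩
  · rintro ⟨i, k⟩ hp
    rw [h.mem] at hp
    have := h.le_of_mem hp
    have := h.le_top_of_mem hp
    simp only
    omega
  · rintro a b ⟨i, k⟩ ⟨j, k'⟩ h₁ h₂
    rw [h.intersectAt_iff] at h₁ h₂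
    have h3 := h.le_top_of_mem h₁.1
    have h4 := h.le_top_of_mem h₂.1
    obtain ⟨rfl, e⟩ := h.meet_unique (m := n) (fun k hk _ => hρ k hk) h₁ h₂ h3 h4
    simp only [Prod.mk.injEq, and_true]
    omega

theorem run_ascent {l : List ℤ} : ∀ {v : ℤ → ℤ} {x y : ℤ}, x < y → run v l x < run v l y →
    (∃ x' y', x' < y' ∧ v x' = run v l x ∧ v y' = run v l y) ∨
      ∃ l₁ r l₂, l = l₁ ++ r :: l₂ ∧ run v l₁ r = run v l y ∧ run v l₁ (r + 1) = run v l x := by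
  induction l with
  | nil => intro v x y hxy h; exact Or.inl ⟨x, y, hxy, rfl, rfl⟩
  | cons r l ih =>
    intro v x y hxy h
    rcases ih hxy h with ⟨x', y', hxy', hx, hy⟩ | ⟨l₁, r', l₂, rfl, h1, h2⟩
    · by_cases hr : x' = r ∧ y' = r + 1
      · refine Or.inr ⟨[], r, l, rfl, ?_, ?_⟩
        · rw [run_cons, ← hy, hr.2]; simp [swp]
        · rw [run_cons, ← hx, hr.1]; simp [swp]
      · refine Or.inl ⟨sw r x', sw r y', by grind [sw], ?_, ?_⟩
        · rw [run_cons, ← hx]; grind [swp, sw]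
        · rw [run_cons, ← hy]; grind [swp, sw]
    · exact Or.inr ⟨r :: l₁, r', l₂, rfl, h1, h2⟩

theorem Rows.meet_of_run (h : Rows n R ρ) {l₁ l₂ : List ℤ} {r : ℤ} (e : ρ k = l₁ ++ r :: l₂)
    (h₁ : run (word ρ (k - 1)) l₁ r = b) (h₂ : run (word ρ (k - 1)) l₁ (r + 1) = a) :
    Meet ρ a b k r := by
  have hs : stage ρ k r = run (word ρ (k - 1)) l₁ := by
    rw [stage, filter_of_eq_append (h.row_sorted k) e]
  refine ⟨by simp [e], Or.inr ?_⟩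
  rw [hs]
  exact ⟨h₁.symm, h₂.symm⟩

/-- The initial word q ↦ -q is decreasing, so a pair in ascending order must have crossed. -/
theorem Rows.meet_of_ascent (h : Rows n R ρ) {x y : ℤ} (hxy : x < y)
    (hlt : word ρ k x < word ρ k y) : ∃ k' q', k' ≤ k ∧ Meet ρ (word ρ k x) (word ρ k y) k' q' := by
  rcases le_or_gt k 0 with hk | hk
  · simp only [word_of_nonpos _ hk] at hlt
    omega
  · obtain ⟨m, rfl⟩ : ∃ m : ℕ, k = m := ⟨k.toNat, by omega⟩
    clear hk
    induction m generalizing x y with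
    | zero => simp only [word_of_nonpos _ (by simp : ((0 : ℕ) : ℤ) ≤ 0)] at hlt; omega
    | succ m ih =>
      have e := h.word_eq ((m + 1 : ℕ) : ℤ)
      rw [e] at hlt
      rcases run_ascent hxy hlt with ⟨x', y', hxy', hx, hy⟩ | ⟨l₁, r, l₂, e', h1, h2⟩
      · have e1 : ((m + 1 : ℕ) : ℤ) - 1 = m := by push_cast; ring
        rw [← hx, ← hy, e1] at hlt
        obtain ⟨k', q', hk', hm⟩ := ih hxy' hlt
        rw [← e, e1] at hx hy
        rw [hx, hy] at hm
        exact ⟨k', q', by push_cast; omega, hm⟩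
      · rw [← e] at h1 h2
        exact ⟨_, r, le_rfl, h.meet_of_run e' h1 h2⟩

/-- Strands in row k have labels at most k, so a crossing in a row k ≤ 0 would involve two
nonpositive ones. An ascending pair has met before and cannot cross again, so every crossing is a
descent, and its larger label is positive. -/
theorem exists_rows (hR : IsRCGraph n R) (hpos : NoNonposIntersect n R) :
    ∃ ρ, Rows n R ρ ∧ Good ρ := by
  have hrow : ∀ i k, (i, k) ∈ R → 0 < k := by
    intro i k hp
    obtain ⟨hi, hk⟩ := hR.1 _ hp
    obtain ⟨⟨a, ha⟩, b, hb⟩ := Enters.exists_of_finset R hi hk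
    have h1 := ha.le_row
    have h2 := hb.le_row
    have h3 := hpos a b (i, k) ⟨hp, Or.inl ⟨ha, hb⟩⟩
    simp only at h1 h2
    omega
  let ρ : ℤ → List ℤ := fun k =>
    ((R.filter (fun p => p.2 = k)).image (fun p => n - p.1 - k)).sort (· ≤ ·)
  have hmem : ∀ k q, q ∈ ρ k ↔ (n - q - k, k) ∈ R := by
    intro k q
    simp only [ρ, Finset.mem_sort, Finset.mem_image, Finset.mem_filter, Prod.exists]
    constructor
    · rintro ⟨i, j, ⟨h1, rfl⟩, rfl⟩
      rwa [show n - (n - i - j) - j = i by ring]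
    · intro h1
      exact ⟨_, _, ⟨h1, rfl⟩, by ring⟩
  have h : Rows n R ρ := by
    refine ⟨fun i k => ?_, fun k => ?_, fun k hk => ?_, fun k hk => ?_⟩
    · rw [hmem, show n - (n - i - k) - k = i by ring]
    · rw [List.pairwise_cons]
      refine ⟨fun q hq => ?_, ?_⟩
      · rw [hmem] at hq
        have := (hR.1 _ hq).1
        simp only at this
        omega
      · exact (Finset.sortedLT_sort _).pairwise
    · rw [List.eq_nil_iff_forall_not_mem]
      intro q hq
      rw [hmem] at hq
      have := hrow _ _ hq
      omega
    · rw [List.eq_nil_iff_forall_not_mem]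
      intro q hq
      rw [hmem] at hq
      have := (hR.1 _ hq).2
      simp only at this
      omega
  refine ⟨ρ, h, fun k hk => ?_⟩
  have hcross : ∀ q ∈ ρ k, Crossing (stage ρ k q) q := by
    intro q hq
    have hmeet : Meet ρ (stage ρ k q q) (stage ρ k q (q + 1)) k q := ⟨hq, Or.inl ⟨rfl, rfl⟩⟩
    have hmeet' : Meet ρ (stage ρ k q q) (stage ρ k q (q + 1)) k (n - (n - q - k) - k) := by
      rwa [show n - (n - q - k) - k = q by ring]
    have hinter := h.intersectAt_iff.2 hmeet'
    have huniq : ∀ k' q', Meet ρ (stage ρ k q q) (stage ρ k q (q + 1)) k' q' → k' = k ∧ q' = q := by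
      intro k' q' hm
      have hm' : Meet ρ (stage ρ k q q) (stage ρ k q (q + 1)) k' (n - (n - q' - k') - k') := by
        rwa [show n - (n - q' - k') - k' = q' by ring]
      have := hR.2 _ _ _ _ (h.intersectAt_iff.2 hm') hinter
      simp only [Prod.mk.injEq] at this
      omega
    have hgt : stage ρ k q (q + 1) < stage ρ k q q := by
      by_contra hle
      have hne : stage ρ k q q ≠ stage ρ k q (q + 1) := fun e => by
        have := stage_injective ρ k q e; omega
      have hlt : stage ρ k q q < stage ρ k q (q + 1) := by omega
      have hxy : q < q + 1 := by omega
      have hlt' := hlt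
      rw [stage] at hlt'
      rcases run_ascent hxy hlt' with ⟨x, y, hxy', hx, hy⟩ | ⟨l₁, r, l₂, e, h1, h2⟩
      · rw [← hx, ← hy] at hlt'
        obtain ⟨k', q', hk', hm⟩ := h.meet_of_ascent hxy' hlt'
        rw [hx, hy] at hm
        have := huniq k' q' hm
        omega
      · have hr : r < q := by
          have : r ∈ (ρ k).filter (· < q) := by rw [e]; simp
          simpa using (List.mem_filter.1 this).2
        have e' := filter_append_filter (h.row_sorted k) q
        rw [e, List.append_assoc, List.cons_append] at e'
        have := huniq k r (h.meet_of_run e'.symm h1 h2)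
        omega
    refine ⟨?_, hgt⟩
    by_contra hle
    have := hpos _ _ _ hinter
    omega
  have key : ∀ l l', ρ k = l ++ l' → RowOK (word ρ (k - 1)) l := by
    intro l
    induction l using List.reverseRecOn with
    | nil => intro _ _; trivial
    | append_singleton l r ih =>
      intro l' e
      rw [List.append_assoc, List.singleton_append] at e
      rw [rowOK_append]
      refine ⟨ih _ e, ?_, trivial⟩
      have := hcross r (by simp [e])
      rwa [stage, filter_of_eq_append (h.row_sorted k) e] at this
  exact key _ [] (by simp)

end

/-! ### The insertion algorithm as a rising hop -/

section
variable {n : ℤ} {R S T U V : Finset (ℤ × ℤ)} {ρ ρT : ℤ → List ℤ} {a b i k k' q q' m x : ℤ}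
  {p p₀ : ℤ × ℤ} {A : ℤ × ℤ}

theorem run_comp (f : ℤ → ℤ) {l : List ℤ} : ∀ {v : ℤ → ℤ}, run (f ∘ v) l = f ∘ run v l := by
  induction l with
  | nil => intro v; rfl
  | cons r l ih =>
    intro v
    have : swp r (r + 1) (f ∘ v) = f ∘ swp r (r + 1) v := by
      funext i; simp only [swp, Function.comp]; split_ifs <;> rfl
    rw [run_cons, run_cons, this, ih]

/-- Exchanging two places of a word is relabelling two strands. A relabelling commutes with
crossings, so it can be carried through the unchanged rows above. -/
theorem swp_eq_comp {v : ℤ → ℤ} (hv : Function.Injective v) (s t : ℤ) :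
    swp s t v = swp (v s) (v t) id ∘ v := by
  funext i
  simp only [swp, Function.comp, id, hv.eq_iff]

theorem Meet.symm (h : Meet ρ a b k q) : Meet ρ b a k q := ⟨h.1, h.2.symm⟩

theorem Meet.of_meet {a' b' : ℤ} (h : Meet ρ a b k q) (h₁ : Meet ρ a' b' k q)
    (h₂ : Meet ρ a' b' k' q') : Meet ρ a b k' q' := by
  have : a' = a ∧ b' = b ∨ a' = b ∧ b' = a := by
    rcases h.2 with h | h <;> rcases h₁.2 with h₁ | h₁ <;> omega
  rcases this with ⟨rfl, rfl⟩ | ⟨rfl, rfl⟩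
  · exact h₂
  · exact h₂.symm

theorem Rows.update (h : Rows n T ρ) {l : List ℤ} (hk : 0 < k) (hkn : k ≤ n)
    (hl : ((-k - 1) :: l).Pairwise (· < ·)) (h₁ : ∀ i, (i, k) ∈ U ↔ n - i - k ∈ l)
    (h₂ : ∀ i k', k' ≠ k → ((i, k') ∈ U ↔ (i, k') ∈ T)) : Rows n U (Function.update ρ k l) := by
  refine ⟨fun i k' => ?_, fun k' => ?_, fun k' hk' => ?_, fun k' hk' => ?_⟩
  · by_cases e : k' = k
    · subst e; simpa using h₁ i
    · rw [h₂ i k' e, h.mem, Function.update_of_ne e]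
  · by_cases e : k' = k
    · subst e; simpa using hl
    · rw [Function.update_of_ne e]; exact h.sorted k'
  · rw [Function.update_of_ne (by omega)]; exact h.nonpos k' hk'
  · rw [Function.update_of_ne (by omega)]; exact h.top k' hk'

theorem run_iff_of_isRCGraph (hT : IsRCGraph n (insert p S)) :
    Run n S p V ↔ V = insert p S := by
  constructor
  · intro h
    cases h with
    | halt _ => rfl
    | bump h _ _ _ _ _ => exact absurd hT h
  · rintro rfl
    exact .halt hT

/-- `Run` leaves a choice of strands and of the place to remove; uniqueness of the second meeting
makes the step deterministic. -/
theorem run_iff_of_bump {l i : ℤ} (hT : ¬ IsRCGraph n (insert p S))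
    (hp : IntersectAt n (insert p S) a b p) (hk : IntersectAt n (insert p S) a b (l, k))
    (hlt : p.2 < k)
    (hu : ∀ a' b' l' k', IntersectAt n (insert p S) a' b' p →
      IntersectAt n (insert p S) a' b' (l', k') → p.2 < k' → l' = l ∧ k' = k)
    (hi : IsLeast {j | l < j ∧ IsOpenSpace n ((insert p S).erase (l, k)) (j, k)} i) :
    Run n S p V ↔ Run n ((insert p S).erase (l, k)) (i, k) V := by
  constructor
  · intro h
    cases h with
    | halt h => exact absurd h hT
    | bump _ h1 h2 h3 h4 h5 =>
      obtain ⟨rfl, rfl⟩ := hu _ _ _ _ h1 h2 h3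
      obtain rfl := h4.unique hi
      exact h5
  · exact .bump hT hp hk hlt hi

/-- The situation in the middle of an insertion into `R`: in the table `T`, which contains the place
`p` added last, the rows up to `m` are done, and the word after them differs by the hop `A` from the
word of `R`; the two strands exchanged by it intersect at `p`. -/
structure Mid (n : ℤ) (ρ : ℤ → List ℤ) (T : Finset (ℤ × ℤ)) (ρT : ℤ → List ℤ) (m : ℤ) (A p : ℤ × ℤ) :
    Prop where
  rows : Rows n T ρT
  pos : 0 < m
  above : ∀ k, m < k → ρT k = ρ k
  ok : ∀ k, 0 < k → k ≤ m → RowOK (word ρT (k - 1)) (ρT k)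
  word_eq : word ρT m = swp A.1 A.2 (word ρ m)
  hop : Hop (word ρ m) A
  le : -m ≤ A.1
  row_le : p.2 ≤ m
  meet : Meet ρT (word ρ m A.1) (word ρ m A.2) p.2 (n - p.1 - p.2)

theorem Mid.word_comp (h : Mid n ρ T ρT m A p) (hR : Rows n R ρ) (hk : m ≤ k) :
    word ρT k = swp (word ρ m A.1) (word ρ m A.2) id ∘ word ρ k := by
  induction k, hk using Int.leInduction with
  | base => rw [h.word_eq, swp_eq_comp (word_injective ρ m)]
  | succ k hk ih =>
    rw [h.rows.word_eq, hR.word_eq (k + 1), add_sub_cancel_right, ih, h.above _ (by omega), run_comp]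

theorem Mid.stage_comp (h : Mid n ρ T ρT m A p) (hR : Rows n R ρ) (hk : m < k) :
    stage ρT k q = swp (word ρ m A.1) (word ρ m A.2) id ∘ stage ρ k q := by
  rw [stage, stage, h.word_comp hR (by omega), h.above _ hk, run_comp]

theorem Mid.meet_of_meet (h : Mid n ρ T ρT m A p) (hR : Rows n R ρ) (hk : m < k)
    (hm : Meet ρT (word ρ m A.1) (word ρ m A.2) k q) :
    Meet ρ (word ρ m A.1) (word ρ m A.2) k q := by
  refine ⟨h.above k hk ▸ hm.1, ?_⟩
  have := hm.2
  rw [h.stage_comp hR hk] at this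
  simp only [Function.comp, swp, id] at this
  grind

/-- The bound on `A'.1` keeps the hop away from strands that have not started yet: they still occupy
their initial places, and words are injective. -/
theorem Mid.rowPass (h : Mid n ρ T ρT m A p) (hR : Rows n R ρ) (hρ : Good ρ) :
    ∃ l A', RowPass (word ρ m) (ρ (m + 1)) A l A' ∧ ((-(m + 1) - 1) :: l).Pairwise (· < ·) ∧
      -(m + 1) ≤ A'.1 := by
  have hp := h.pos
  have hok := hρ (m + 1) (by omega)
  rw [add_sub_cancel_right] at hok
  have hun : ∀ q, q < -m → word ρ m q = -q := fun q hq => hR.word_unborn hq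
  have hle := h.le
  obtain ⟨l, A', h1, h2⟩ := RowPass.exists (p' := -(m + 1) - 1) (hR.sorted (m + 1))
    (by rw [hun _ (by omega)]; omega) (by omega) le_rfl h.hop hok
  refine ⟨l, A', h1, h2, ?_⟩
  rcases h1.same_or_bump h.hop hok (hR.row_sorted _) with ⟨rfl, e, -⟩ |
    ⟨l₁, r, l₂, j, -, rfl, -, -, -, rfl⟩
  · by_contra hlt
    have e' := hR.word_unborn (k := m + 1) (q := A'.1) (by omega)
    rw [hR.word_eq, add_sub_cancel_right, e, ← hun _ (by omega)] at e'
    have := word_injective ρ m e'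
    omega
  · have := (List.pairwise_cons.1 h2).1 j (by simp)
    simp only
    omega

theorem Mid.run_of_top (h : Mid n ρ T ρT m A p) (hR : Rows n R ρ) (hm : n ≤ m) :
    ∃ (ρU : ℤ → List ℤ) (σ : ℤ → ℤ × ℤ), Rows n T ρU ∧ (∀ k, k ≤ m → ρU k = ρT k) ∧ σ m = A ∧
      (∀ k, m < k → RowPass (word ρ (k - 1)) (ρ k) (σ (k - 1)) (ρU k) (σ k)) ∧
      ∀ S V, insert p S = T → (Run n S p V ↔ V = T) := by
  refine ⟨ρT, fun _ => A, h.rows, fun _ _ => rfl, rfl, ?_, ?_⟩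
  · intro k hk
    rw [h.above k hk, hR.top k (by omega)]
    exact .nil
  · rintro S V rfl
    refine run_iff_of_isRCGraph (h.rows.isRCGraph fun k hk => ?_)
    rcases le_or_gt k m with hkm | hkm
    · exact h.ok k hk hkm
    · rw [h.above k hkm, hR.top k (by omega)]
      trivial

theorem Mid.step_same (h : Mid n ρ T ρT m A p) (hρ : Good ρ) {A' : ℤ × ℤ}
    (hp : RowPass (word ρ m) (ρ (m + 1)) A (ρ (m + 1)) A') (hle : -(m + 1) ≤ A'.1)
    (h₁ : run (word ρ m) (ρ (m + 1)) A'.1 = word ρ m A.1)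
    (h₂ : run (word ρ m) (ρ (m + 1)) A'.2 = word ρ m A.2) : Mid n ρ T ρT (m + 1) A' p := by
  have hpos := h.pos
  have hok := hρ (m + 1) (by omega)
  have hw : word ρ (m + 1) = run (word ρ m) (ρ (m + 1)) := by
    rw [word_of_pos ρ (by omega : 0 < m + 1), add_sub_cancel_right]
  rw [add_sub_cancel_right] at hok
  refine ⟨h.rows, by omega, fun k hk => h.above k (by omega), fun k hk hkm => ?_, ?_, ?_, hle,
    by have := h.row_le; omega, ?_⟩
  · rcases hkm.lt_or_eq with hlt | rfl
    · exact h.ok k hk (by omega)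
    · rw [add_sub_cancel_right, h.above _ (by omega), h.word_eq]
      exact hp.rowOK h.hop hok
  · rw [h.rows.word_eq, add_sub_cancel_right, h.word_eq, h.above _ (by omega), hw]
    exact hp.run_eq h.hop hok
  · rw [hw]; exact hp.hop h.hop hok
  · rw [hw, h₁, h₂]; exact h.meet

/-- The two strands exchanged by the hop meet again at r in row m + 1, so the algorithm removes that
crossing. The landing place of the pass is the open space it selects next. -/
theorem Mid.step_bump (h : Mid n ρ T ρT m A p) (hR : Rows n R ρ) (hρ : Good ρ) {l₁ l₂ : List ℤ}
    {r j : ℤ} (hp : RowPass (word ρ m) (ρ (m + 1)) A (l₁ ++ j :: l₂) (j, j + 1))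
    (hs : ((-(m + 1) - 1) :: (l₁ ++ j :: l₂)).Pairwise (· < ·)) (e : ρ (m + 1) = l₁ ++ r :: l₂)
    (h₁ : run (word ρ m) l₁ r = word ρ m A.1) (h₂ : run (word ρ m) l₁ (r + 1) = word ρ m A.2)
    (hL : LastPos (run (word ρ m) l₁) r j) :
    Mid n ρ (insert (n - j - (m + 1), m + 1) (T.erase (n - r - (m + 1), m + 1)))
        (Function.update ρT (m + 1) (l₁ ++ j :: l₂)) (m + 1) (j, j + 1) (n - j - (m + 1), m + 1) ∧
      ∀ S V, insert p S = T → (Run n S p V ↔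
        Run n (T.erase (n - r - (m + 1), m + 1)) (n - j - (m + 1), m + 1) V) := by
  have hpos := h.pos
  have hok := hρ (m + 1) (by omega)
  have hw : word ρ (m + 1) = run (word ρ m) (ρ (m + 1)) := by
    rw [word_of_pos ρ (by omega : 0 < m + 1), add_sub_cancel_right]
  rw [add_sub_cancel_right] at hok
  have hj := hL.lt
  have hmn : m + 1 ≤ n := by
    by_contra hc
    have := hR.top (m + 1) (by omega)
    simp [e] at this
  have eT : ρT (m + 1) = l₁ ++ r :: l₂ := by rw [h.above _ (by omega), e]
  have sT := h.rows.sorted (m + 1)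
  rw [eT] at sT
  have sT1 := List.pairwise_cons.1 sT
  have sT2 := List.pairwise_append.1 sT1.2
  have sT3 := List.pairwise_cons.1 sT2.2.1
  have s1 := List.pairwise_cons.1 hs
  have s2 := List.pairwise_append.1 s1.2
  have l1r : ∀ c ∈ l₁, c < r := fun c hc => sT2.2.2 c hc r (by simp)
  have l1j : ∀ c ∈ l₁, c < j := fun c hc => s2.2.2 c hc j (by simp)
  have l2r : ∀ c ∈ l₂, r < c := sT3.1
  set v := run (word ρ m) l₁ with hv
  have hvinj : Function.Injective v := run_injective (word_injective ρ m)
  set τ := swp (word ρ m A.1) (word ρ m A.2) id with hτ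
  have hvT : run (word ρT m) l₁ = τ ∘ v := by
    rw [h.word_comp hR le_rfl, run_comp]
  have hA1 := h.hop.pos
  have hA2 := h.hop.nonpos
  have τr : τ (v r) = v (r + 1) := by rw [h₁, h₂, hτ]; simp [swp]
  have τr1 : τ (v (r + 1)) = v r := by rw [h₁, h₂, hτ]; simp only [swp]; split_ifs <;> simp_all
  have τi : ∀ i, i < r → τ (v i) = v i := by
    intro i hi
    have n1 : v i ≠ v r := fun e => by have := hvinj e; omega
    have n2 : v i ≠ v (r + 1) := fun e => by have := hvinj e; omega
    rw [h₁] at n1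
    rw [h₂] at n2
    rw [hτ]; simp [swp, n1, n2]
  have meetR : Meet ρ (word ρ m A.1) (word ρ m A.2) (m + 1) r := by
    refine (hR.meet_of_run e ?_ ?_).symm
    · rw [add_sub_cancel_right]; exact h₁
    · rw [add_sub_cancel_right]; exact h₂
  have meetT : Meet ρT (word ρ m A.1) (word ρ m A.2) (m + 1) r := by
    refine h.rows.meet_of_run eT ?_ ?_
    · rw [add_sub_cancel_right, hvT, Function.comp, τr, h₂]
    · rw [add_sub_cancel_right, hvT, Function.comp, τr1, h₁]
  have hlow : ∀ l k, k ≤ m → word (Function.update ρT (m + 1) l) k = word ρT k := fun l k hk =>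
    word_congr fun i _ hi => Function.update_of_ne (by omega) _ _
  have rowsE : Rows n (T.erase (n - r - (m + 1), m + 1))
      (Function.update ρT (m + 1) (l₁ ++ l₂)) := by
    refine h.rows.update (by omega) hmn ?_ (fun i => ?_) (fun i k' hk' => ?_)
    · refine sT.sublist (List.Sublist.cons_cons _ ?_)
      exact List.Sublist.append_left (List.sublist_cons_self _ _) _
    · rw [Finset.mem_erase, h.rows.mem, eT]
      simp only [ne_eq, Prod.mk.injEq, and_true, List.mem_append, List.mem_cons]
      constructor
      · rintro ⟨h1, h2 | h2 | h2⟩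
        · exact Or.inl h2
        · omega
        · exact Or.inr h2
      · rintro (h2 | h2)
        · have := l1r _ h2
          exact ⟨by omega, Or.inl h2⟩
        · have := l2r _ h2
          exact ⟨by omega, Or.inr (Or.inr h2)⟩
    · rw [Finset.mem_erase]
      simp [hk']
  have rowsI : Rows n (insert (n - j - (m + 1), m + 1) (T.erase (n - r - (m + 1), m + 1)))
      (Function.update ρT (m + 1) (l₁ ++ j :: l₂)) := by
    have := rowsE.update (U := insert (n - j - (m + 1), m + 1) (T.erase (n - r - (m + 1), m + 1)))
      (k := m + 1) (l := l₁ ++ j :: l₂) (by omega) hmn hs (fun i => ?_) (fun i k' hk' => ?_)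
    · rwa [Function.update_idem] at this
    · rw [Finset.mem_insert, rowsE.mem, Function.update_self]
      simp only [Prod.mk.injEq, and_true, List.mem_append, List.mem_cons]
      have : i = n - j - (m + 1) ↔ n - i - (m + 1) = j := by omega
      tauto
    · rw [Finset.mem_insert]
      simp [hk']
  constructor
  · refine ⟨rowsI, by omega, fun k hk => ?_, fun k hk hkm => ?_, ?_, ?_, ?_, le_rfl, ?_⟩
    · rw [Function.update_of_ne (by omega), h.above k (by omega)]
    · rcases hkm.lt_or_eq with hlt | rfl
      · rw [Function.update_of_ne (by omega), hlow _ _ (by omega)]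
        exact h.ok k hk (by omega)
      · rw [add_sub_cancel_right, Function.update_self, hlow _ _ le_rfl, h.word_eq]
        exact hp.rowOK h.hop hok
    · rw [rowsI.word_eq, add_sub_cancel_right, hlow _ _ le_rfl, h.word_eq, Function.update_self, hw]
      exact hp.run_eq h.hop hok
    · rw [hw]; exact hp.hop h.hop hok
    · have := s1.1 j (by simp)
      simp only; omega
    · have e1 : word ρ (m + 1) j = v j := by
        rw [hw, e, run_append, run_of_gt]
        intro c hc
        rcases List.mem_cons.1 hc with rfl | hc
        · exact hj
        · have := l2r c hc; omega
      have e2 : word ρ (m + 1) (j + 1) = if j + 1 = r then v (r + 1) else v (j + 1) := by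
        rw [hw, e, run_append, run_cons, run_of_gt]
        · simp only [swp]
          rw [if_neg (show ¬ (j + 1 = r + 1) by omega)]
        · intro c hc
          have := l2r c hc; omega
      simp only
      rw [show n - (n - j - (m + 1)) - (m + 1) = j by ring]
      refine (rowsI.meet_of_run (l₁ := l₁) (l₂ := l₂) (by simp) ?_ ?_).symm
      · rw [add_sub_cancel_right, hlow _ _ le_rfl, hvT, Function.comp, τi _ hj, e1]
      · rw [add_sub_cancel_right, hlow _ _ le_rfl, hvT, Function.comp, e2]
        split_ifs with hjr
        · rw [hjr, τr]
        · exact τi _ (by omega)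
  · rintro S V rfl
    have hrow := h.row_le
    have ip : IntersectAt n (insert p S) (word ρ m A.1) (word ρ m A.2) (p.1, p.2) :=
      h.rows.intersectAt_iff.2 h.meet
    have ir : IntersectAt n (insert p S) (word ρ m A.1) (word ρ m A.2)
        (n - r - (m + 1), m + 1) := by
      rw [h.rows.intersectAt_iff, show n - (n - r - (m + 1)) - (m + 1) = r by ring]
      exact meetT
    refine run_iff_of_bump (a := word ρ m A.1) (b := word ρ m A.2) ?_ ip ir (by omega) ?_ ?_
    · intro hRC
      have := hRC.2 _ _ _ _ ip ir
      simp only [Prod.mk.injEq] at this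
      omega
    · intro a' b' l' k' i1 i2 hk'
      have i1' := h.rows.intersectAt_iff.1 (show IntersectAt n (insert p S) a' b' (p.1, p.2) from i1)
      have i2' := h.meet.of_meet i1' (h.rows.intersectAt_iff.1 i2)
      -- Up to row m the table has no double meeting, so nothing above p is found there. Above row m
      -- a meeting in `T` is one in `R`, where these strands meet only at r.
      rcases le_or_gt k' m with hkm | hkm
      · have := h.rows.meet_unique h.ok h.meet i2' hrow hkm
        omega
      · have i3 := h.meet_of_meet hR hkm i2'
        have := hR.meet_unique (m := n) (fun k hk _ => hρ k hk) i3 meetR (hR.le_top_of_mem i3.1) hmn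
        omega
    -- Columns above l are coordinates below r, and the smallest column is the largest coordinate.
    -- From j to r the erased row has no crossing, so open spaces are read off from τ ∘ v.
    · have hstage : ∀ q, j ≤ q → q ≤ r →
          stage (Function.update ρT (m + 1) (l₁ ++ l₂)) (m + 1) q = τ ∘ v := by
        intro q hq hq'
        have f1 : l₁.filter (· < q) = l₁ := by
          rw [List.filter_eq_self]
          intro c hc
          have := l1j c hc
          simp; omega
        have f2 : l₂.filter (· < q) = [] := by
          rw [List.filter_eq_nil_iff]
          intro c hc
          have := l2r c hc
          simp; omega
        rw [stage, Function.update_self, List.filter_append, f1, f2, List.append_nil,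
          add_sub_cancel_right, hlow _ _ le_rfl, hvT]
      constructor
      · refine ⟨by omega, ?_⟩
        rw [rowsE.isOpenSpace_iff, show n - (n - j - (m + 1)) - (m + 1) = j by ring,
          hstage j le_rfl hj.le, Function.update_self]
        have := s1.1 j (by simp)
        refine ⟨by omega, hmn, ?_, ?_, ?_⟩
        · rw [List.mem_append]
          rintro (hc | hc)
          · have := l1j _ hc; omega
          · have := l2r _ hc; omega
        · rw [Function.comp, τi _ hj]; exact hL.pos
        · rw [Function.comp]
          rcases (show j + 1 ≤ r by omega).eq_or_lt with hjr | hjr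
          · rw [hjr, τr, h₂]; exact hA2
          · rw [τi _ hjr]; exact hL.nonpos _ (by omega) hjr
      · rintro i ⟨hi, ho⟩
        rw [rowsE.isOpenSpace_iff] at ho
        obtain ⟨-, -, -, ho, -⟩ := ho
        by_contra hlt
        rw [hstage _ (by omega) (by omega), Function.comp, τi _ (by omega)] at ho
        have := hL.nonpos (n - i - (m + 1)) (by omega) (by omega)
        omega

/-- Here d bounds the number of rows left below the top n. A row without a bump leaves the table
untouched and only advances the hop; a row with a bump is one step of `Run`. -/
theorem Mid.run (hR : Rows n R ρ) (hρ : Good ρ) (d : ℕ) :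
    ∀ {T : Finset (ℤ × ℤ)} {ρT : ℤ → List ℤ} {m : ℤ} {A p : ℤ × ℤ}, n ≤ m + d →
    Mid n ρ T ρT m A p → ∃ (U : Finset (ℤ × ℤ)) (ρU : ℤ → List ℤ) (σ : ℤ → ℤ × ℤ),
      Rows n U ρU ∧ (∀ k, k ≤ m → ρU k = ρT k) ∧ σ m = A ∧
      (∀ k, m < k → RowPass (word ρ (k - 1)) (ρ k) (σ (k - 1)) (ρU k) (σ k)) ∧
      ∀ S V, insert p S = T → (Run n S p V ↔ V = U) := by
  induction d with
  | zero =>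
    intro T ρT m A p hd h
    exact ⟨T, h.run_of_top hR (by simpa using hd)⟩
  | succ d ih =>
    intro T ρT m A p hd h
    obtain ⟨l, A', hp, hs, hle⟩ := h.rowPass hR hρ
    have hpos := h.pos
    have hok := hρ (m + 1) (by omega)
    rw [add_sub_cancel_right] at hok
    have hd' : n ≤ m + 1 + d := by push_cast at hd; omega
    have glue : ∀ {ρU : ℤ → List ℤ} {σ : ℤ → ℤ × ℤ}, ρU (m + 1) = l → σ (m + 1) = A' →
        (∀ k, m + 1 < k → RowPass (word ρ (k - 1)) (ρ k) (σ (k - 1)) (ρU k) (σ k)) →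
        ∀ k, m < k → RowPass (word ρ (k - 1)) (ρ k) (Function.update σ m A (k - 1)) (ρU k)
          (Function.update σ m A k) := by
      intro ρU σ e1 e2 e3 k hk
      rw [Function.update_of_ne (show k ≠ m by omega)]
      rcases (show m + 1 ≤ k by omega).eq_or_lt with rfl | hk'
      · rw [add_sub_cancel_right, Function.update_self, e1, e2]
        exact hp
      · rw [Function.update_of_ne (by omega)]
        exact e3 k hk'
    rcases hp.same_or_bump h.hop hok (hR.row_sorted _) with ⟨rfl, h1, h2⟩ |
      ⟨l₁, r, l₂, j, e, rfl, h1, h2, hL, rfl⟩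
    · obtain ⟨U, ρU, σ, k1, k2, k3, k4, k5⟩ := ih hd' (h.step_same hρ hp hle h1 h2)
      refine ⟨U, ρU, Function.update σ m A, k1, fun k hk => k2 k (by omega), by simp,
        glue ?_ k3 k4, k5⟩
      rw [k2 _ le_rfl, h.above _ (by omega)]
    · obtain ⟨hM, hrun⟩ := h.step_bump hR hρ hp hs e h1 h2 hL
      obtain ⟨U, ρU, σ, k1, k2, k3, k4, k5⟩ := ih hd' hM
      refine ⟨U, ρU, Function.update σ m A, k1, fun k hk => ?_, by simp, glue ?_ k3 k4,
        fun S V hS => ?_⟩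
      · rw [k2 k (by omega), Function.update_of_ne (by omega)]
      · rw [k2 _ le_rfl, Function.update_self]
      · rw [hrun S V hS]
        exact k5 _ V rfl

/-! ### The start of an insertion, and the conclusion -/

theorem word_eventually (ρ : ℤ → List ℤ) (k : ℤ) : ∃ N, ∀ q, N ≤ q → word ρ k q = -q := by
  unfold word
  induction k.toNat with
  | zero => exact ⟨0, fun q _ => rfl⟩
  | succ m ih =>
    obtain ⟨N, hN⟩ := ih
    obtain ⟨M, hM⟩ : ∃ M, ∀ r ∈ ρ (m + 1), r + 1 < M := by
      obtain ⟨M, hM⟩ := (ρ (m + 1)).toFinset.bddAbove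
      refine ⟨M + 2, fun r hr => ?_⟩
      have := hM (a := r) (by simpa using hr)
      omega
    refine ⟨max N M, fun q hq => ?_⟩
    rw [wordNat, run_of_lt, hN q (by omega)]
    intro r hr
    have := hM r hr
    omega

theorem exists_isLast (ρ : ℤ → List ℤ) (hR : Rows n R ρ) (k : ℤ) (hk : 0 ≤ k) : ∃ j, IsLast (word ρ k) j := by
  obtain ⟨N, hN⟩ := word_eventually ρ k
  obtain ⟨j, hj, hm⟩ := Int.exists_greatest_of_bdd (P := fun j => 0 < word ρ k j)
    ⟨max N 0, fun z hz => by
      by_contra hc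
      rw [hN z (by omega)] at hz
      omega⟩ ⟨-k - 1, by rw [hR.word_unborn (by omega)]; omega⟩
  refine ⟨j, hj, fun i hi => ?_⟩
  by_contra hc
  have := hm i (by omega)
  omega

theorem Rows.lt_of_isLast (hR : Rows n R ρ) (hρ : Good ρ) (hx : 0 < x) {j : ℤ}
    (hj : IsLast (word ρ x) j) : -x ≤ j ∧ ∀ r ∈ ρ x, r < j := by
  -- The sentinel -x - 1 works because the place -x still carries the strand x, which is positive.
  have h1 := run_pos_after (hR.sorted x) (v := word ρ (x - 1))
    (by rw [hR.word_unborn (by omega)]; omega) (hρ x hx)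
  obtain ⟨q, hq, hq', hqp⟩ := h1
  rw [← hR.word_eq] at hqp
  have : q < j := by
    by_contra hc
    have := hj.2 (q + 1) (by omega)
    omega
  refine ⟨by omega, fun r hr => ?_⟩
  have := hq' r hr
  omega

theorem inserts_iff (hR : Rows n R ρ) (hρ : Good ρ) (hx : 0 < x) (hxn : x ≤ n) :
    ∃ U ρU σ, Rows n U ρU ∧ InsRows ρ x ρU σ ∧ ∀ V, Inserts n R x V ↔ V = U := by
  obtain ⟨j, hj⟩ := exists_isLast ρ hR x hx.le
  obtain ⟨hjx, hrow⟩ := hR.lt_of_isLast hρ hx hj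
  have hnot : j ∉ ρ x := fun h => by have := hrow j h; omega
  have hfil : ∀ q, j ≤ q → stage ρ x q = word ρ x := by
    intro q hq
    rw [stage, hR.word_eq x, List.filter_eq_self.2]
    intro r hr
    have := hrow r hr
    simp; omega
  -- No crossing of row x lies at or beyond j, so the word after the row decides which places there
  -- are open: j is the largest such coordinate, that is, the smallest column.
  have hleast : IsLeast {i | IsOpenSpace n R (i, x)} (n - j - x) := by
    constructor
    · change IsOpenSpace n R (n - j - x, x)
      rw [hR.isOpenSpace_iff, show n - (n - j - x) - x = j by ring, hfil j le_rfl]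
      exact ⟨by omega, hxn, hnot, hj.1, hj.2 _ (by omega)⟩
    · intro i hi
      change IsOpenSpace n R (i, x) at hi
      rw [hR.isOpenSpace_iff] at hi
      by_contra hlt
      have h1 := hi.2.2.2.1
      rw [hfil _ (by omega)] at h1
      have := hj.2 (n - i - x) (by omega)
      omega
  have hsort : ((-x - 1) :: (ρ x ++ [j])).Pairwise (· < ·) := by
    rw [← List.cons_append, List.pairwise_append]
    refine ⟨hR.sorted x, by simp, ?_⟩
    intro a ha b hb
    rw [List.mem_singleton] at hb
    subst hb
    rcases List.mem_cons.1 ha with rfl | ha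
    · omega
    · exact hrow a ha
  have hrows : Rows n (insert (n - j - x, x) R) (Function.update ρ x (ρ x ++ [j])) := by
    refine hR.update hx hxn hsort (fun i => ?_) (fun i k' hk' => ?_)
    · rw [Finset.mem_insert, hR.mem]
      simp only [Prod.mk.injEq, and_true, List.mem_append, List.mem_singleton]
      have : i = n - j - x ↔ n - i - x = j := by omega
      tauto
    · rw [Finset.mem_insert]
      simp [hk']
  have hlow : ∀ k, k < x → word (Function.update ρ x (ρ x ++ [j])) k = word ρ k := fun k hk =>
    word_congr fun i _ hi => Function.update_of_ne (by omega) _ _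
  have hmid : Mid n ρ (insert (n - j - x, x) R) (Function.update ρ x (ρ x ++ [j])) x (j, j + 1)
      (n - j - x, x) := by
    refine ⟨hrows, hx, fun k hk => Function.update_of_ne (by omega) _ _, fun k hk hkx => ?_, ?_,
      hj.hop, hjx, le_rfl, ?_⟩
    · rw [hlow _ (by omega)]
      rcases hkx.lt_or_eq with hlt | rfl
      · rw [Function.update_of_ne (by omega)]; exact hρ k hk
      · rw [Function.update_self, rowOK_append, ← hR.word_eq]
        exact ⟨hρ k hk, hj.crossing, trivial⟩
    · rw [hrows.word_eq, hlow _ (by omega), Function.update_self, run_append, ← hR.word_eq]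
      rfl
    · simp only
      rw [show n - (n - j - x) - x = j by ring]
      refine (hrows.meet_of_run (l₁ := ρ x) (l₂ := []) (by simp) ?_ ?_).symm <;>
        rw [hlow _ (by omega), ← hR.word_eq]
  obtain ⟨U, ρU, σ, k1, k2, k3, k4, k5⟩ := Mid.run hR hρ (n - x).toNat (by omega) hmid
  refine ⟨U, ρU, σ, k1, ⟨fun k hk => ?_, ?_, ?_, ?_, k4⟩, fun V => ?_⟩
  · rw [k2 k hk.le, Function.update_of_ne (by omega)]
  · rw [k2 x le_rfl, Function.update_self, k3]
  · rw [k3]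
  · rw [k3]; exact hj
  · constructor
    · rintro ⟨i, hi, hrun⟩
      obtain rfl := hi.unique hleast
      exact (k5 R V rfl).1 hrun
    · intro hV
      exact ⟨_, hleast, (k5 R V rfl).2 hV⟩

theorem insertsWord_iff (hR : Rows n R ρ) (hρ : Good ρ) (hx : 0 < x) (hxn : x ≤ n) :
    ∃ U ρU σ, Rows n U ρU ∧ Good ρU ∧ InsRows ρ x ρU σ ∧
      ∀ w V, InsertsWord n R (x :: w) V ↔ InsertsWord n U w V := by
  obtain ⟨U, ρU, σ, h1, h2, h3⟩ := inserts_iff hR hρ hx hxn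
  refine ⟨U, ρU, σ, h1, h2.good hρ hx, h2, fun w V => ?_⟩
  simp only [InsertsWord, h3, exists_eq_left]

end

end RCGraph

theorem lemma4p4 (n : ℤ) (R : Finset (ℤ × ℤ)) (hR : RCGraph.IsRCGraph n R)
    (hpos : RCGraph.NoNonposIntersect n R) :
    (∀ x y z : ℤ, 0 < x → x < y → y ≤ z → z ≤ n →
      RCGraph.SameInsertion n R [y, x, z] [y, z, x]) ∧
    (∀ x y z : ℤ, 0 < x → x ≤ y → y < z → z ≤ n →
      RCGraph.SameInsertion n R [x, z, y] [z, x, y]) := by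
  obtain ⟨ρ, h, hρ⟩ := RCGraph.exists_rows hR hpos
  constructor
  · intro x y z hx hxy hyz hzn
    obtain ⟨R₁, ρ₁, σ₁, r₁, g₁, i₁, w₁⟩ :=
      RCGraph.insertsWord_iff h hρ (show 0 < y by omega) (by omega)
    obtain ⟨R₂, ρ₂, σ₂, r₂, g₂, i₂, w₂⟩ := RCGraph.insertsWord_iff r₁ g₁ hx (by omega)
    obtain ⟨R₃, ρ₃, σ₃, r₃, g₃, i₃, w₃⟩ :=
      RCGraph.insertsWord_iff r₂ g₂ (show 0 < z by omega) hzn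
    obtain ⟨S₂, μ₂, τ₂, s₂, t₂, j₂, u₂⟩ :=
      RCGraph.insertsWord_iff r₁ g₁ (show 0 < z by omega) hzn
    obtain ⟨S₃, μ₃, τ₃, s₃, t₃, j₃, u₃⟩ := RCGraph.insertsWord_iff s₂ t₂ hx (by omega)
    obtain rfl := RCGraph.InsRows.knuth_right hρ hx hxy hyz i₁ i₂ i₃ j₂ j₃
    obtain rfl := r₃.eq s₃
    refine ⟨R₃, fun V => ?_, fun V => ?_⟩
    · rw [w₁, w₂, w₃]; rfl
    · rw [w₁, u₂, u₃]; rfl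
  · intro x y z hx hxy hyz hzn
    obtain ⟨R₁, ρ₁, σ₁, r₁, g₁, i₁, w₁⟩ := RCGraph.insertsWord_iff h hρ hx (by omega)
    obtain ⟨R₂, ρ₂, σ₂, r₂, g₂, i₂, w₂⟩ :=
      RCGraph.insertsWord_iff r₁ g₁ (show 0 < z by omega) hzn
    obtain ⟨R₃, ρ₃, σ₃, r₃, g₃, i₃, w₃⟩ :=
      RCGraph.insertsWord_iff r₂ g₂ (show 0 < y by omega) (by omega)
    obtain ⟨S₁, μ₁, τ₁, s₁, t₁, j₁, u₁⟩ :=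
      RCGraph.insertsWord_iff h hρ (show 0 < z by omega) hzn
    obtain ⟨S₂, μ₂, τ₂, s₂, t₂, j₂, u₂⟩ := RCGraph.insertsWord_iff s₁ t₁ hx (by omega)
    obtain ⟨S₃, μ₃, τ₃, s₃, t₃, j₃, u₃⟩ :=
      RCGraph.insertsWord_iff s₂ t₂ (show 0 < y by omega) (by omega)
    obtain rfl := RCGraph.InsRows.knuth_left hρ hx hxy hyz i₁ i₂ i₃ j₁ j₂ j₃
    obtain rfl := r₃.eq s₃
    refine ⟨R₃, fun V => ?_, fun V => ?_⟩
    · rw [w₁, w₂, w₃]; rfl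
    · rw [u₁, u₂, u₃]; rfl
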